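/- **Setting.** Let $d\in\mathbb N_0$, $0\le k\le r$ integers, and write $P_s$ for the polynomials of degree at most $s$ ($P_{-1}=\{0\}$). Let $\widehat{\mathscr I}$ be a linear functional on $C^{q}([-1,1])$ (the reference integrator) and $\widehat{\mathcal I}$ a linear operator on $C^{p}([-1,1])$ with $\widehat{\mathcal I}v\in C^l([-1,1])$ for all $v\in C^{\max\{p,l\}}([-1,1])$, $l\in\mathbb N_0$; both act componentwise on vector-valued functions. Assume: 1. if $\psi\in P_{r-\max\{1,k\}}$ and $\widehat{\mathscr I}\big[(1-x)^{\lfloor k/2\rfloor}(1+x)^{|\lfloor (k-1)/2\rfloor|}\psi\varphi\big]=0$ for all $\varphi\in P_{r-\max\{1,k\}}$, then $\psi=0$; 2. $\|\widehat{\mathscr I}[\varphi]\|\le \mathfrak C_0\sum_{j=0}^{q}\sup_{[-1,1]}\|\varphi^{(j)}\|$ for all $\varphi\in C^{q}([-1,1],\mathbb R^d)$; 3. for $0\le l\le q$, $\sup_{[-1,1]}\|(\widehat{\mathcal I}\varphi)^{(l)}\|\le \mathfrak C_1\sum_{j=0}^{\max\{p,l\}}\sup_{[-1,1]}\|\varphi^{(j)}\|$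 for all $\varphi\in C^{\max\{p,l\}}([-1,1],\mathbb R^d)$. On an interval $I_n=(t_{n-1},t_n]$ with $\tau_n=t_n-t_{n-1}$ and the affine bijection $T_n:[-1,1]\to\overline{I_n}$, $T_n(x)=\frac{t_{n-1}+t_n}2+\frac{\tau_n}2x$, put $\mathscr I_n[\varphi]=\frac{\tau_n}2\widehat{\mathscr I}[\varphi\circ T_n]$ and $\mathcal I_n\psi=\big(\widehat{\mathcal I}(\psi\circ T_n)\big)\circ T_n^{-1}$. Let $r_{\rm ex},r_{I,i}\in\{-1,0,1,\dots,\infty\}$ be the largest numbers such that $\int_{-1}^1\varphi=\widehat{\mathscr I}[\varphi]$ for all $\varphi\in P_{r_{\rm ex}}$, and $\widehat{\mathscr I}[\varphi\psi]=\widehat{\mathscr I}[(\widehat{\mathcal I}\varphi)\psi]$ for all $\varphi\in P_{r_{I,i}}$, $\psi\in P_i$. Set $r_{\rm var}=\min_{0\le i\le r-k}(r_{I,i}+i)$ and $$\sigma=\min\big\{2r-k+1,\ r_{\rm var}+1,\ \max\{r_{\rm ex}+1,\min\{r,r_{I,r-k}+1\}\}\big\}.$$ Let $T>0$, $I=(t_0,t_0+T]$,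 and let $u$ solve $u'(t)=f(t,u(t))$ on $[t_0,t_0+T]$, $u(t_0)=u_0\in\mathbb R^d$, where $f:[t_0,t_0+T]\times\mathbb R^d\to\mathbb R^d$ is Lipschitz in the second variable uniformly in $t$, and of class $C^m$. For a mesh $t_0<t_1<\dots<t_N=t_0+T$ with $\tau=\max_n\tau_n\le 1$, a discrete solution is a function $U$ with $U(t_0^-)=u_0$ that on each $I_n$ is a polynomial of degree at most $r$ with values in $\mathbb R^d$ and satisfies * $U(t_{n-1}^+)=U(t_{n-1}^-)$ if $k\ge1$; * $U^{(i+1)}(t_n^-)=\frac{d^i}{dt^i}f(t,U(t))\big|_{t=t_n^-}$ for $0\le i\le\lfloor k/2\rfloor-1$ if $k\ge 2$; * $U^{(i+1)}(t_{n-1}^+)=\frac{d^i}{dt^i}f(t,U(t))\big|_{t=t_{n-1}^+}$ for $0\le i\le\lfloor (k-1)/2\rfloor-1$ if $k\ge 3$; * $\mathscr I_n[(U',\varphi)]+\delta_{0,k}\big(U(t_{n-1}^+)-U(t_{n-1}^-),\varphi(t_{n-1}^+)\big)=\mathscr I_n\big[(\mathcal I_nf(\cdot,U(\cdot)),\varphi)\big]$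 for all $\mathbb R^d$-valued polynomials $\varphi$ of degree at most $r-k$. **Theorem.** There is $m\in\mathbb N_0$, depending only on $d$, $r$, $k$, $\widehat{\mathscr I}$, $\widehat{\mathcal I}$, such that for all $t_0,T,f,u_0,u$ as above ($f$ of class $C^m$) and every bound $K$ there is a constant $C$ with the following property. For every mesh as above and every discrete solution $U$ on it such that $\sup_{I}\|u-U\|\le K$ and $\sup_{I_n}\|U^{(l)}\|\le K$ for all $l\ge0$ and $1\le n\le N$, $$\|(u-U)(t_N^-)\|\le C\Big(\sup_{t\in I}\|(u-U)(t)\|^2+\tau^{\sigma}\Big).$$ -/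

import Mathlib

/-- The Euclidean space `ℝ^d`. -/
abbrev Vec (d : ℕ) : Type := EuclideanSpace ℝ (Fin d)

/-- The closed reference interval `[-1, 1]`. -/
abbrev RefIcc : Set ℝ := Set.Icc (-1) 1

/-- `sup_{t ∈ s} ‖g t‖`. It is used for functions that are bounded on `s` only. -/
noncomputable def supNormOn {E : Type*} [NormedAddCommGroup E] (s : Set ℝ) (g : ℝ → E) : ℝ :=
  sSup ((fun t => ‖g t‖) '' s)

/-- `φ ∈ P_s(ℝ, ℝ^d)`: a polynomial of degree at most `s` with coefficients in `ℝ^d`. -/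
def IsVecPoly {d : ℕ} (s : ℕ) (φ : ℝ → Vec d) : Prop :=
  ∃ c : ℕ → Vec d, ∀ t, φ t = ∑ i ∈ Finset.range (s + 1), t ^ i • c i

/-- A reference integrator: a linear functional on `C^q([-1,1])`. Elements of `C^q([-1,1])` are
represented by functions on `ℝ` of which only the restriction to `[-1,1]` matters; the values of
`toFun` on other functions are irrelevant. -/
structure RefIntegrator (q : ℕ) where
  toFun : (ℝ → ℝ) → ℝ
  congr : ∀ v w, ContDiffOn ℝ q v RefIcc → Set.EqOn v w RefIcc → toFun v = toFun w
  map_add : ∀ v w, ContDiffOn ℝ q v RefIcc → ContDiffOn ℝ q w RefIcc →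
    toFun (fun x => v x + w x) = toFun v + toFun w
  map_smul : ∀ (c : ℝ) (v), ContDiffOn ℝ q v RefIcc → toFun (fun x => c * v x) = c * toFun v

/-- A reference approximation operator: a linear operator on `C^q([-1,1])` with values in the
functions on `[-1,1]`, such that the image of `v` is at least as smooth as `v`. -/
structure RefApprox (q : ℕ) where
  toFun : (ℝ → ℝ) → ℝ → ℝ
  congr : ∀ v w, ContDiffOn ℝ q v RefIcc → Set.EqOn v w RefIcc →
    Set.EqOn (toFun v) (toFun w) RefIcc
  map_add : ∀ v w, ContDiffOn ℝ q v RefIcc → ContDiffOn ℝ q w RefIcc →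
    Set.EqOn (toFun (fun x => v x + w x)) (fun x => toFun v x + toFun w x) RefIcc
  map_smul : ∀ (c : ℝ) (v), ContDiffOn ℝ q v RefIcc →
    Set.EqOn (toFun (fun x => c * v x)) (fun x => c * toFun v x) RefIcc
  smooth : ∀ (l : ℕ) (v), ContDiffOn ℝ ((max q l : ℕ) : WithTop ℕ∞) v RefIcc →
    ContDiffOn ℝ l (toFun v) RefIcc

/-- The affine map of `[-1,1]` onto `[a,b]`. -/
noncomputable def fromRef (a b x : ℝ) : ℝ := (a + b) / 2 + (b - a) / 2 * x

/-- The affine map of `[a,b]` onto `[-1,1]`, the inverse of `fromRef a b`. -/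
noncomputable def toRef (a b t : ℝ) : ℝ := (2 * t - (a + b)) / (b - a)

namespace RefIntegrator

variable {q : ℕ}

/-- Componentwise action on vector-valued functions. -/
noncomputable def vec {d : ℕ} (Q : RefIntegrator q) (φ : ℝ → Vec d) : Vec d :=
  WithLp.toLp 2 fun j => Q.toFun fun x => φ x j

/-- The integrator on the interval `[a,b]`, obtained by transformation. -/
noncomputable def onInterval (Q : RefIntegrator q) (a b : ℝ) (φ : ℝ → ℝ) : ℝ :=
  (b - a) / 2 * Q.toFun fun x => φ (fromRef a b x)

/-- Unisolvence: if `ψ ∈ P_{r - max{1,k}}` and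
`Q[(1-t)^⌊k/2⌋ (1+t)^|⌊(k-1)/2⌋| ψ φ] = 0` for all `φ ∈ P_{r - max{1,k}}`, then `ψ = 0`.
Here `Polynomial.degreeLT ℝ (s + 1)` is `P_s` and `Polynomial.degreeLT ℝ 0 = {0}` is `P_{-1}`. -/
def Unisolvent (Q : RefIntegrator q) (r k : ℕ) : Prop :=
  ∀ ψ ∈ Polynomial.degreeLT ℝ (r + 1 - max 1 k),
    (∀ φ ∈ Polynomial.degreeLT ℝ (r + 1 - max 1 k),
      Q.toFun (fun x => (1 - x) ^ (k / 2) * (1 + x) ^ (((k : ℤ) - 1) / 2).natAbs *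
        ψ.eval x * φ.eval x) = 0) → ψ = 0

/-- Stability: `‖Q[φ]‖ ≤ C ∑_{j ≤ q} sup_{[-1,1]} ‖φ^{(j)}‖` for all `φ ∈ C^q([-1,1], ℝ^d)`. -/
def Stable (Q : RefIntegrator q) (d : ℕ) : Prop :=
  ∃ C : ℝ, ∀ φ : ℝ → Vec d, ContDiffOn ℝ q φ RefIcc →
    ‖Q.vec φ‖ ≤ C * ∑ j ∈ Finset.range (q + 1), supNormOn RefIcc (iteratedDerivWithin j φ RefIcc)

/-- One plus the largest `s ∈ {-1, 0, 1, …, ∞}` such that `∫ φ = Q[φ]` for all `φ ∈ P_s`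
(with `P_{-1} = {0}`). -/
noncomputable def exactSucc (Q : RefIntegrator q) : ℕ∞ :=
  ⨆ (m : ℕ) (_ : ∀ φ ∈ Polynomial.degreeLT ℝ m,
    ∫ x in (-1 : ℝ)..1, φ.eval x = Q.toFun fun x => φ.eval x), (m : ℕ∞)

/-- One plus the largest `s ∈ {-1, 0, 1, …, ∞}` such that `Q[φ ψ] = Q[(A φ) ψ]` for all
`φ ∈ P_s` and all `ψ ∈ P_i` (with `P_{-1} = {0}`). -/
noncomputable def compatSucc {p : ℕ} (Q : RefIntegrator q) (A : RefApprox p) (i : ℕ) : ℕ∞ :=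
  ⨆ (m : ℕ) (_ : ∀ φ ∈ Polynomial.degreeLT ℝ m, ∀ ψ ∈ Polynomial.degreeLT ℝ (i + 1),
    Q.toFun (fun x => φ.eval x * ψ.eval x) =
      Q.toFun (fun x => A.toFun (fun y => φ.eval y) x * ψ.eval x)), (m : ℕ∞)

end RefIntegrator

namespace RefApprox

variable {p : ℕ}

/-- Componentwise action on vector-valued functions. -/
noncomputable def vec {d : ℕ} (A : RefApprox p) (φ : ℝ → Vec d) : ℝ → Vec d :=
  fun x => WithLp.toLp 2 fun j => A.toFun (fun y => φ y j) x

/-- The approximation operator on the interval `[a,b]`, obtained by transformation. -/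
noncomputable def onInterval {d : ℕ} (A : RefApprox p) (a b : ℝ) (φ : ℝ → Vec d) : ℝ → Vec d :=
  fun t => A.vec (fun x => φ (fromRef a b x)) (toRef a b t)

/-- Stability: for `0 ≤ l ≤ q` and all `φ ∈ C^{max{p,l}}([-1,1], ℝ^d)`,
`sup_{[-1,1]} ‖(A φ)^{(l)}‖ ≤ C ∑_{j ≤ max{p,l}} sup_{[-1,1]} ‖φ^{(j)}‖`. -/
def Stable (A : RefApprox p) (d q : ℕ) : Prop :=
  ∃ C : ℝ, ∀ l ≤ q, ∀ φ : ℝ → Vec d, ContDiffOn ℝ ((max p l : ℕ) : WithTop ℕ∞) φ RefIcc →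
    supNormOn RefIcc (iteratedDerivWithin l (A.vec φ) RefIcc) ≤
      C * ∑ j ∈ Finset.range (max p l + 1), supNormOn RefIcc (iteratedDerivWithin j φ RefIcc)

end RefApprox

/-- `t 0 < t 1 < … < t N` is a mesh of `[t₀, t₀ + T]` all of whose steps are at most `1`. -/
structure IsMesh (t₀ T : ℝ) (N : ℕ) (t : ℕ → ℝ) : Prop where
  first : t 0 = t₀
  last : t N = t₀ + T
  lt : ∀ n < N, t n < t (n + 1)
  step_le_one : ∀ n < N, t (n + 1) - t n ≤ 1

/-- The mesh size `τ = max_n (t_{n+1} - t_n)`. -/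
noncomputable def meshSize (N : ℕ) (t : ℕ → ℝ) : ℝ :=
  ⨆ n : Fin N, (t (n + 1) - t n)

/-- The local problem of the variational time discretization method with parameters `r, k` on the
interval `(a, b]`: the polynomial `P` is a solution for the incoming value `U₀`. The derivatives of
`t ↦ f (t, P t)` at the end points are the one-sided ones, taken within `[a, b]`. -/
structure IsLocalSolution {d q p : ℕ} (r k : ℕ) (Q : RefIntegrator q) (A : RefApprox p)
    (f : ℝ → Vec d → Vec d) (a b : ℝ) (U₀ : Vec d) (P : ℝ → Vec d) : Prop where
  poly : IsVecPoly r P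
  initial : 1 ≤ k → P a = U₀
  right : ∀ i < k / 2, iteratedDeriv (i + 1) P b =
    iteratedDerivWithin i (fun t => f t (P t)) (Set.Icc a b) b
  left : ∀ i < (k - 1) / 2, iteratedDeriv (i + 1) P a =
    iteratedDerivWithin i (fun t => f t (P t)) (Set.Icc a b) a
  variational : ∀ φ : ℝ → Vec d, IsVecPoly (r - k) φ →
    Q.onInterval a b (fun t => inner ℝ (deriv P t) (φ t)) +
        (if k = 0 then inner ℝ (P a - U₀) (φ a) else 0) =
      Q.onInterval a b (fun t => inner ℝ (A.onInterval a b (fun s => f s (P s)) t) (φ t))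

/-- `U` is a discrete solution on the mesh `t 0 < … < t N`: it has the initial value `u₀` and is on
every `(t_n, t_{n+1}]` a polynomial that solves the local problem. As `U` is continuous from the
left on `(t 0, t N]`, the limit of `U` at `t_n` from the left is `U (t n)`; for `n = 0` this is the
convention that the value of `U` before the first step is `u₀`. -/
structure IsDiscreteSolution {d q p : ℕ} (r k : ℕ) (Q : RefIntegrator q) (A : RefApprox p)
    (f : ℝ → Vec d → Vec d) (u₀ : Vec d) (N : ℕ) (t : ℕ → ℝ) (U : ℝ → Vec d) : Prop where
  initial : U (t 0) = u₀
  step : ∀ n < N, ∃ P : ℝ → Vec d, Set.EqOn U P (Set.Ioc (t n) (t (n + 1))) ∧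
    IsLocalSolution r k Q A f (t n) (t (n + 1)) (U (t n)) P

/-- The exponent `min {2r-k+1, r_var+1, max {r_ex+1, min {r, r_{I,r-k}+1}}}` where
`r_var = min_{0 ≤ i ≤ r-k} (r_{I,i} + i)`. It is at most `2r-k+1`, so finite. -/
noncomputable def superOrder {q p : ℕ} (r k : ℕ) (Q : RefIntegrator q) (A : RefApprox p) : ℕ :=
  ENat.toNat (min ((2 * r - k + 1 : ℕ) : ℕ∞)
    (min (⨅ i ∈ Finset.range (r - k + 1), (Q.compatSucc A i + i))
      (max Q.exactSucc (min (r : ℕ∞) (Q.compatSucc A (r - k))))))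

/-!
The error at a mesh point is estimated one step at a time, by a duality argument on the reference
interval `[-1, 1]`; a discrete Gronwall inequality then sums the local errors.

On a step `[a, b]` of length `h`, write `P` for the polynomial `U`, `F = f(·, P)`, `e = u - P`, and
`R = F - P'` for the defect. As `e' = R + ∂ₓf(·, P) e + O(‖e‖²)`, an operator valued `Z` with
`Z' = -Z ∂ₓf(·, P) + O(h^σ)` and `Z(b) = 1` gives
`e(b) = Z(a) e(a⁺) + ∫ Z R + O(h (‖e‖² + h^σ))` (`norm_apply_sub_apply_sub_integral_le`). A Picard
iterate is a sufficient `Z` (`exists_picard_iterate`). Linearizing at `P` and not at `u` has the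
advantage that the derivatives of all functions involved are bounded by those of `f` and `U` alone.
Transformed to `[-1, 1]` they are bounded by a constant times powers of `h` (`ScaledBound`).

It remains to see that `∫ Z R`, minus the jump term for `k = 0`, is `O(h · h^σ)`. This is a
statement about the scalar entries (`RefProblem.exists_abs_defect_functional_le`). By unisolvence
and the end point conditions, `R = O(h^s)` in `C^M` for `s ≤ min {r, r_{I,r-k} + 1}`
(`RefProblem.exists_scaledBound_defect`). If `σ ≤ min {r, r_{I,r-k} + 1}`, this suffices. Otherwise
`σ ≤ r_ex + 1`, so the integral can be replaced by the integrator `Q`. A Taylor polynomial `φ` of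
degree `r - k` of an entry `z` of `Z` is an admissible test function, whence `Q[R φ]` is, up to the
jump term, `Q[(F - A F) φ]`. The term of degree `i` of `φ` has a coefficient `O(h^i)` and is
compatible with `A` up to degree `r_{I,i}`, so that it contributes `O(h^{i + r_{I,i} + 1})`. The
rest `Q[R (z - φ)]` is `O(h^s · h^{r-k+1})`. The bounds `r_var + 1` and `2 r - k + 1` for `σ` are
what these two terms require.
-/

open Polynomial

/-! ### Functions whose derivatives scale with the step size -/

theorem uniqueDiffOn_refIcc : UniqueDiffOn ℝ RefIcc := uniqueDiffOn_Icc (by norm_num)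

/-- `g` is `M` times continuously differentiable on the reference interval, and its derivatives
satisfy `‖g^{(l)}‖ ≤ C h^l` for `l ≤ M`. This is the form that a uniform bound on the derivatives
of a function on an interval of length `h` takes on the reference interval. With `h = 1` it is a
bound for the `C^M` norm. -/
def ScaledBound {E : Type*} [NormedAddCommGroup E] [NormedSpace ℝ E] (M : ℕ) (h C : ℝ)
    (g : ℝ → E) : Prop :=
  ContDiffOn ℝ M g RefIcc ∧
    ∀ l ≤ M, ∀ x ∈ RefIcc, ‖iteratedDerivWithin l g RefIcc x‖ ≤ C * h ^ l

namespace ScaledBound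

variable {E F G : Type*} [NormedAddCommGroup E] [NormedSpace ℝ E] [NormedAddCommGroup F]
  [NormedSpace ℝ F] [NormedAddCommGroup G] [NormedSpace ℝ G] {M : ℕ} {h C D : ℝ}
  {g : ℝ → E}

theorem norm_le (hg : ScaledBound M h C g) {x : ℝ} (hx : x ∈ RefIcc) : ‖g x‖ ≤ C := by
  simpa using hg.2 0 (Nat.zero_le _) x hx

theorem nonneg (hg : ScaledBound M h C g) : 0 ≤ C :=
  (norm_nonneg _).trans (hg.norm_le (x := 0) (by simp))

theorem congr {g' : ℝ → E} (hg : ScaledBound M h C g) (hgg : Set.EqOn g g' RefIcc) :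
    ScaledBound M h C g' :=
  ⟨hg.1.congr fun x hx => (hgg hx).symm, fun l hl x hx => by
    rw [← iteratedDerivWithin_congr hgg hx]; exact hg.2 l hl x hx⟩

theorem mono (hg : ScaledBound M h C g) (h0 : 0 ≤ h) (hCD : C ≤ D) : ScaledBound M h D g :=
  ⟨hg.1, fun l hl x hx => (hg.2 l hl x hx).trans (by gcongr)⟩

theorem of_le {M' : ℕ} (hg : ScaledBound M h C g) (hM : M' ≤ M) : ScaledBound M' h C g :=
  ⟨hg.1.of_le (by exact_mod_cast hM), fun l hl => hg.2 l (hl.trans hM)⟩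

theorem to_one (hg : ScaledBound M h C g) (h0 : 0 ≤ h) (h1 : h ≤ 1) : ScaledBound M 1 C g :=
  ⟨hg.1, fun l hl x hx => (hg.2 l hl x hx).trans (by
    rw [one_pow]; exact mul_le_mul_of_nonneg_left (pow_le_one₀ h0 h1) hg.nonneg)⟩

theorem continuousOn (hg : ScaledBound M h C g) : ContinuousOn g RefIcc := hg.1.continuousOn

theorem contDiffWithinAt (hg : ScaledBound M h C g) {l : ℕ} (hl : l ≤ M) {x : ℝ}
    (hx : x ∈ RefIcc) : ContDiffWithinAt ℝ l g RefIcc x :=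
  (hg.1 x hx).of_le (by exact_mod_cast hl)

theorem zero_order (hg : ContinuousOn g RefIcc) (hC : ∀ x ∈ RefIcc, ‖g x‖ ≤ C) :
    ScaledBound 0 h C g := by
  refine ⟨by simpa using hg, fun l hl x hx => ?_⟩
  obtain rfl : l = 0 := by omega
  simpa using hC x hx

theorem const (c : E) (h0 : 0 ≤ h) : ScaledBound M h ‖c‖ (fun _ : ℝ => c) := by
  refine ⟨contDiffOn_const, fun l hl x hx => ?_⟩
  rw [iteratedDerivWithin_const]
  split_ifs with h
  · simp [h]
  · simp only [norm_zero]; positivity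

theorem zero (h0 : 0 ≤ h) : ScaledBound M h 0 (fun _ : ℝ => (0 : E)) := by
  simpa using const (M := M) (0 : E) h0

theorem add {g' : ℝ → E} (hg : ScaledBound M h C g) (hg' : ScaledBound M h D g') :
    ScaledBound M h (C + D) (fun x => g x + g' x) := by
  refine ⟨hg.1.add hg'.1, fun l hl x hx => ?_⟩
  rw [iteratedDerivWithin_fun_add hx uniqueDiffOn_refIcc (hg.contDiffWithinAt hl hx)
    (hg'.contDiffWithinAt hl hx), add_mul]
  exact (norm_add_le _ _).trans (add_le_add (hg.2 l hl x hx) (hg'.2 l hl x hx))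

theorem neg (hg : ScaledBound M h C g) : ScaledBound M h C (fun x => -g x) := by
  refine ⟨hg.1.neg, fun l hl x hx => ?_⟩
  rw [iteratedDerivWithin_fun_neg, norm_neg]
  exact hg.2 l hl x hx

theorem sub {g' : ℝ → E} (hg : ScaledBound M h C g) (hg' : ScaledBound M h D g') :
    ScaledBound M h (C + D) (fun x => g x - g' x) := by
  simpa only [sub_eq_add_neg] using hg.add hg'.neg

theorem sum {ι : Type*} (s : Finset ι) {g : ι → ℝ → E} {C : ι → ℝ} (h0 : 0 ≤ h)
    (hg : ∀ i ∈ s, ScaledBound M h (C i) (g i)) :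
    ScaledBound M h (∑ i ∈ s, C i) (fun x => ∑ i ∈ s, g i x) := by
  classical
  induction s using Finset.induction_on with
  | empty => simpa using zero h0
  | insert a s ha ih =>
    simp only [Finset.sum_insert ha]
    exact (hg a (by simp)).add (ih fun i hi => hg i (by simp [hi]))

theorem clm (L : E →L[ℝ] F) (hg : ScaledBound M h C g) :
    ScaledBound M h (‖L‖ * C) (fun x => L (g x)) := by
  refine ⟨L.contDiff.comp_contDiffOn hg.1, fun l hl x hx => ?_⟩
  have := L.norm_iteratedFDerivWithin_comp_left (hg.1 x hx) uniqueDiffOn_refIcc hx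
    (n := l) (by exact_mod_cast hl)
  rw [norm_iteratedFDerivWithin_eq_norm_iteratedDerivWithin,
    norm_iteratedFDerivWithin_eq_norm_iteratedDerivWithin] at this
  refine this.trans ?_
  rw [mul_assoc]
  exact mul_le_mul_of_nonneg_left (hg.2 l hl x hx) (norm_nonneg _)

theorem const_smul (c : ℝ) (hg : ScaledBound M h C g) :
    ScaledBound M h (|c| * C) (fun x => c • g x) := by
  refine ⟨contDiffOn_const.smul hg.1, fun l hl x hx => ?_⟩
  rw [iteratedDerivWithin_fun_const_smul hx uniqueDiffOn_refIcc c (hg.contDiffWithinAt hl hx),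
    norm_smul, Real.norm_eq_abs, mul_assoc]
  exact mul_le_mul_of_nonneg_left (hg.2 l hl x hx) (abs_nonneg _)

theorem bilin (B : E →L[ℝ] F →L[ℝ] G) {k : ℝ → F} (h0 : 0 ≤ h) (hg : ScaledBound M h C g)
    (hk : ScaledBound M h D k) :
    ScaledBound M h (‖B‖ * (2 ^ M * C * D)) (fun x => B (g x) (k x)) := by
  have hC := hg.nonneg
  have hD := hk.nonneg
  refine ⟨B.isBoundedBilinearMap.contDiff.comp_contDiffOn (hg.1.prodMk hk.1),
    fun l hl x hx => ?_⟩
  have := B.norm_iteratedFDerivWithin_le_of_bilinear hg.1 hk.1 uniqueDiffOn_refIcc hx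
    (n := l) (by exact_mod_cast hl)
  simp only [norm_iteratedFDerivWithin_eq_norm_iteratedDerivWithin] at this
  refine this.trans ?_
  rw [mul_assoc]
  refine mul_le_mul_of_nonneg_left ?_ (norm_nonneg B)
  calc _ ≤ ∑ i ∈ Finset.range (l + 1), (l.choose i : ℝ) * (C * h ^ i) * (D * h ^ (l - i)) := by
        refine Finset.sum_le_sum fun i hi => ?_
        have hi' : i ≤ l := by simpa [Nat.lt_succ_iff] using hi
        have h1 := hg.2 i (hi'.trans hl) x hx
        have h2 := hk.2 (l - i) ((Nat.sub_le _ _).trans hl) x hx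
        gcongr
    _ = (∑ i ∈ Finset.range (l + 1), (l.choose i : ℝ)) * (C * D * h ^ l) := by
        rw [Finset.sum_mul]
        refine Finset.sum_congr rfl fun i hi => ?_
        have hi' : i ≤ l := by simpa [Nat.lt_succ_iff] using hi
        rw [← Nat.add_sub_cancel' hi', pow_add]
        simp only [Nat.add_sub_cancel_left]
        ring
    _ = 2 ^ l * (C * D * h ^ l) := by
        congr 1
        exact_mod_cast Nat.sum_range_choose l
    _ ≤ 2 ^ M * (C * D * h ^ l) := by
        gcongr
        norm_num
    _ = _ := by ring

theorem mul {u v : ℝ → ℝ} (h0 : 0 ≤ h) (hu : ScaledBound M h C u) (hv : ScaledBound M h D v) :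
    ScaledBound M h (2 ^ M * C * D) (fun x => u x * v x) := by
  have := bilin (ContinuousLinearMap.mul ℝ ℝ) h0 hu hv
  simpa using this

/-- If `g' = h k` and the derivatives of `k` scale with `h`, then so do those of `g`. -/
theorem of_hasDeriv {k : ℝ → E} (h0 : 0 ≤ h) (hk : ScaledBound M h C k)
    (hg : ∀ x ∈ RefIcc, HasDerivWithinAt g (h • k x) RefIcc x) (hC : ∀ x ∈ RefIcc, ‖g x‖ ≤ C) :
    ScaledBound (M + 1) h C g := by
  have hd : Set.EqOn (derivWithin g RefIcc) (fun x => h • k x) RefIcc := fun x hx =>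
    (hg x hx).derivWithin (uniqueDiffOn_refIcc x hx)
  refine ⟨?_, fun l hl x hx => ?_⟩
  · have : ((M + 1 : ℕ) : WithTop ℕ∞) = (M : WithTop ℕ∞) + 1 := by push_cast; rfl
    rw [this, contDiffOn_succ_iff_derivWithin uniqueDiffOn_refIcc]
    refine ⟨fun x hx => (hg x hx).differentiableWithinAt, fun h => by simp at h, ?_⟩
    exact (contDiffOn_const.smul hk.1).congr hd
  · rcases l with _ | l
    · simpa using hC x hx
    · rw [iteratedDerivWithin_succ', iteratedDerivWithin_congr hd hx,
        iteratedDerivWithin_fun_const_smul hx uniqueDiffOn_refIcc h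
          (hk.contDiffWithinAt (by omega) hx), norm_smul, Real.norm_eq_abs, abs_of_nonneg h0]
      calc _ ≤ h * (C * h ^ l) := by
            gcongr
            exact hk.2 l (by omega) x hx
        _ = _ := by ring

/-- Composition with a function whose derivatives are bounded on the range. -/
theorem comp {Φ : E → F} {s s' : Set E} (hΦ : ContDiffOn ℝ M Φ s) (hs : UniqueDiffOn ℝ s)
    (hD : ∀ i ≤ M, ∀ y ∈ s', ‖iteratedFDerivWithin ℝ i Φ s y‖ ≤ D) (h0 : 0 ≤ h)
    (hg : ScaledBound M h C g) (hC : 1 ≤ C) (hgs : Set.MapsTo g RefIcc s)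
    (hgs' : Set.MapsTo g RefIcc s') :
    ScaledBound M h (M.factorial * D * C ^ M) (fun x => Φ (g x)) := by
  have hD0 : 0 ≤ D := (norm_nonneg _).trans (hD 0 (Nat.zero_le _) _ (hgs' (x := 0) (by simp)))
  refine ⟨hΦ.comp hg.1 hgs, fun l hl x hx => ?_⟩
  have := norm_iteratedFDerivWithin_comp_le hΦ hg.1 (n := l) (by exact_mod_cast hl) hs
    uniqueDiffOn_refIcc hgs hx (C := D) (D := C * h) (fun i hi => hD i (hi.trans hl) _ (hgs' hx))
    (fun i hi hil => by
      rw [norm_iteratedFDerivWithin_eq_norm_iteratedDerivWithin, mul_pow]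
      refine (hg.2 i (hil.trans hl) x hx).trans ?_
      gcongr
      exact le_self_pow₀ hC (by omega))
  rw [norm_iteratedFDerivWithin_eq_norm_iteratedDerivWithin] at this
  refine this.trans ?_
  rw [mul_pow, ← mul_assoc]
  gcongr

end ScaledBound

/-! ### Polynomials on the reference interval -/

theorem iteratedDerivWithin_polynomial (p : ℝ[X]) (l : ℕ) {x : ℝ} (hx : x ∈ RefIcc) :
    iteratedDerivWithin l (fun y => p.eval y) RefIcc x = (derivative^[l] p).eval x := by
  induction l generalizing x with
  | zero => simp
  | succ l ih =>
    rw [iteratedDerivWithin_succ, Function.iterate_succ_apply',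
      derivWithin_congr (fun y hy => ih hy) (ih hx)]
    exact ((derivative^[l] p).hasDerivAt x).hasDerivWithinAt.derivWithin
      (uniqueDiffOn_refIcc x hx)

/-- The derivatives of `p` on the reference interval are bounded by its coefficients. -/
theorem ScaledBound.polynomial (M r : ℕ) : ∃ D : ℝ, 0 ≤ D ∧ ∀ (p : ℝ[X]) (c : ℝ),
    p ∈ degreeLT ℝ r → (∀ i < r, |p.coeff i| ≤ c) → 0 ≤ c →
      ScaledBound M 1 (D * c) (fun x => p.eval x) := by
  have hX : ∀ i : ℕ, ∃ D : ℝ, 0 ≤ D ∧ ScaledBound M 1 D (fun x : ℝ => x ^ i) := by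
    intro i
    induction i with
    | zero => exact ⟨1, zero_le_one, by simpa using ScaledBound.const (M := M) (1 : ℝ) zero_le_one⟩
    | succ i ih =>
      obtain ⟨D, hD, h⟩ := ih
      have hid : ScaledBound M 1 1 (fun x : ℝ => x) := by
        have h1 : ∀ x ∈ RefIcc, ‖x‖ ≤ 1 := fun x hx => abs_le.2 hx
        rcases M with _ | M
        · exact ScaledBound.zero_order continuousOn_id h1
        · refine ScaledBound.of_hasDeriv (k := fun _ => 1) zero_le_one ?_ (fun x hx => ?_) h1
          · simpa using ScaledBound.const (M := M) (1 : ℝ) zero_le_one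
          · simpa using (hasDerivAt_id' x).hasDerivWithinAt (s := RefIcc)
      exact ⟨2 ^ M * D * 1, by positivity, by
        simpa only [pow_succ] using ScaledBound.mul zero_le_one h hid⟩
  choose D hD hXD using hX
  refine ⟨∑ i ∈ Finset.range r, D i, Finset.sum_nonneg fun i _ => hD i, fun p c hp hc hc0 => ?_⟩
  have hpe : ∀ x, p.eval x = ∑ i ∈ Finset.range r, p.coeff i • x ^ i := by
    intro x
    rcases Nat.eq_zero_or_pos r with rfl | hr
    · have : p = 0 := by simpa [mem_degreeLT, Nat.WithBot.lt_zero_iff] using hp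
      simp [this]
    · have : p.natDegree < r := by
        rcases eq_or_ne p 0 with rfl | h0
        · simpa using hr
        · exact (natDegree_lt_iff_degree_lt h0).2 (mem_degreeLT.1 hp)
      rw [eval_eq_sum_range' this]
      rfl
  simp only [hpe]
  refine (ScaledBound.sum _ zero_le_one fun i _ => (hXD i).const_smul (p.coeff i)).mono
    zero_le_one ?_
  rw [Finset.sum_mul]
  refine Finset.sum_le_sum fun i hi => ?_
  rw [mul_comm]
  exact mul_le_mul_of_nonneg_left (hc i (Finset.mem_range.1 hi)) (hD i)

/-- Taylor's formula at the left end point of the reference interval. -/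
theorem ScaledBound.taylor {M s : ℕ} {h C : ℝ} {v : ℝ → ℝ} (hv : ScaledBound M h C v)
    (h0 : 0 ≤ h) (h1 : h ≤ 1) (hs : s ≤ M) :
    ∃ c : ℕ → ℝ, (∀ i < s, |c i| ≤ C * h ^ i) ∧
      ScaledBound M 1 (2 ^ s * C * h ^ s) (fun x => v x - ∑ i ∈ Finset.range s, c i * (1 + x) ^ i) ∧
      (0 < s → v (-1) = ∑ i ∈ Finset.range s, c i * (1 + (-1)) ^ i) := by
  have hC := hv.nonneg
  have hm1 : (-1 : ℝ) ∈ RefIcc := by simp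
  set c : ℕ → ℝ := fun i => iteratedDerivWithin i v RefIcc (-1) / i.factorial with hc
  set P : ℝ[X] := ∑ i ∈ Finset.range s, Polynomial.C (c i) * (X + Polynomial.C 1) ^ i with hP
  have hPe : ∀ x, P.eval x = ∑ i ∈ Finset.range s, c i * (1 + x) ^ i := by
    intro x
    simp [hP, eval_finsetSum, add_comm]
  have hPd : ∀ l < s, (derivative^[l] P).eval (-1) = iteratedDerivWithin l v RefIcc (-1) := by
    intro l hl
    rw [hP, Polynomial.iterate_derivative_sum, eval_finsetSum, Finset.sum_eq_single l]
    · rw [iterate_derivative_C_mul, iterate_derivative_X_add_pow]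
      simp [hc, Nat.descFactorial_self]
      field_simp
    · intro i _ hil
      rw [iterate_derivative_C_mul, iterate_derivative_X_add_pow]
      rcases lt_or_gt_of_ne hil with h | h
      · simp [Nat.descFactorial_eq_zero_iff_lt.2 h]
      · have : i - l ≠ 0 := by omega
        simp [this]
    · intro h
      exact absurd (Finset.mem_range.2 hl) h
  have hPs : ∀ l, s ≤ l → derivative^[l] P = 0 := by
    intro l hl
    rw [hP, Polynomial.iterate_derivative_sum]
    refine Finset.sum_eq_zero fun i hi => ?_
    rw [iterate_derivative_C_mul, iterate_derivative_X_add_pow,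
      Nat.descFactorial_eq_zero_iff_lt.2 ((Finset.mem_range.1 hi).trans_le hl)]
    simp
  have hPc : ContDiff ℝ M (fun x => P.eval x) := by
    simpa using P.contDiff_aeval (𝕜 := ℝ) M
  have hcd : ContDiffOn ℝ M (fun x => v x - P.eval x) RefIcc :=
    hv.1.sub hPc.contDiffOn
  have hd : ∀ l ≤ M, ∀ x ∈ RefIcc, iteratedDerivWithin l (fun x => v x - P.eval x) RefIcc x =
      iteratedDerivWithin l v RefIcc x - (derivative^[l] P).eval x := by
    intro l hl x hx
    rw [← iteratedDerivWithin_polynomial P l hx]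
    exact iteratedDerivWithin_sub hx uniqueDiffOn_refIcc (hv.contDiffWithinAt hl hx)
      (hPc.of_le (by exact_mod_cast hl)).contDiffAt.contDiffWithinAt
  -- The derivatives of the remainder of order below `s` vanish at `-1`; they are bounded one after
  -- the other by the mean value inequality, downwards from order `s`.
  have hlow : ∀ j ≤ s, ∀ x ∈ RefIcc,
      ‖iteratedDerivWithin (s - j) (fun x => v x - P.eval x) RefIcc x‖ ≤ 2 ^ j * (C * h ^ s) := by
    intro j
    induction j with
    | zero =>
      intro _ x hx
      rw [Nat.sub_zero, hd s hs x hx, hPs s le_rfl]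
      simpa using hv.2 s hs x hx
    | succ j ih =>
      intro hj x hx
      have hsucc : s - j = s - (j + 1) + 1 := by omega
      have hb := Convex.norm_image_sub_le_of_norm_derivWithin_le
        (f := iteratedDerivWithin (s - (j + 1)) (fun x => v x - P.eval x) RefIcc)
        (C := 2 ^ j * (C * h ^ s)) (s := RefIcc) (x := -1) (y := x)
        (hcd.differentiableOn_iteratedDerivWithin (by exact_mod_cast (by omega))
          uniqueDiffOn_refIcc)
        (fun y hy => by
          rw [← iteratedDerivWithin_succ, ← hsucc]
          exact ih (by omega) y hy) (convex_Icc _ _) hm1 hx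
      rw [hd _ (by omega) (-1) hm1, hPd _ (by omega), sub_self, sub_zero] at hb
      refine hb.trans ?_
      have : ‖x - -1‖ ≤ 2 := by
        rw [Real.norm_eq_abs, abs_le]
        constructor <;> linarith [hx.1, hx.2]
      calc _ ≤ 2 ^ j * (C * h ^ s) * 2 := by gcongr
        _ = _ := by ring
  refine ⟨c, fun i hi => ?_, ?_, fun hs0 => ?_⟩
  · rw [hc]
    simp only [abs_div, Nat.abs_cast]
    refine (div_le_self (abs_nonneg _) ?_).trans (hv.2 i (by omega) _ hm1)
    exact_mod_cast Nat.one_le_iff_ne_zero.2 i.factorial_ne_zero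
  · simp only [← hPe]
    refine ⟨hcd, fun l hl x hx => ?_⟩
    rw [one_pow, mul_one, mul_assoc]
    rcases le_total l s with hls | hls
    · have := hlow (s - l) (by omega) x hx
      rw [Nat.sub_sub_self hls] at this
      refine this.trans ?_
      gcongr
      · norm_num
      · omega
    · rw [hd l hl x hx, hPs l hls, eval_zero, sub_zero]
      refine (hv.2 l hl x hx).trans ?_
      calc C * h ^ l ≤ C * h ^ s :=
            mul_le_mul_of_nonneg_left (pow_le_pow_of_le_one h0 h1 hls) hC
        _ ≤ 2 ^ s * (C * h ^ s) := le_mul_of_one_le_left (by positivity) (one_le_pow₀ (by norm_num))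
  · have := hPd 0 hs0
    simp only [Function.iterate_zero, id, iteratedDerivWithin_zero] at this
    rw [← this, hPe]

/-! ### Integrators and approximation operators on scaled functions -/


/-- A supremum of natural numbers over a downward closed condition is attained from below. -/
theorem of_le_iSup_enat {P : ℕ → Prop} (h0 : P 0) (hP : ∀ m n, m ≤ n → P n → P m) {s : ℕ}
    (hs : (s : ℕ∞) ≤ ⨆ (m : ℕ) (_ : P m), (m : ℕ∞)) : P s := by
  rcases s with _ | s
  · exact h0
  · have : (s : ℕ∞) < ⨆ (m : ℕ) (_ : P m), (m : ℕ∞) :=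
      lt_of_lt_of_le (by exact_mod_cast Nat.lt_succ_self s) hs
    simp only [lt_iSup_iff] at this
    obtain ⟨m, hm, hsm⟩ := this
    exact hP _ m (by exact_mod_cast hsm) hm

theorem contDiff_polynomial_eval (P : ℝ[X]) (n : WithTop ℕ∞) :
    ContDiff ℝ n (fun x => P.eval x) := by
  simpa using P.contDiff_aeval (𝕜 := ℝ) n

theorem X_add_one_pow_mem_degreeLT {i s : ℕ} (hi : i < s) :
    (X + Polynomial.C 1 : ℝ[X]) ^ i ∈ degreeLT ℝ s := by
  rw [mem_degreeLT, degree_pow, degree_X_add_C, nsmul_one]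
  exact_mod_cast hi

theorem exists_polynomial_eval_eq_sum (s : ℕ) (c : ℕ → ℝ) : ∃ T ∈ degreeLT ℝ s,
    ∀ x, T.eval x = ∑ i ∈ Finset.range s, c i * (1 + x) ^ i := by
  refine ⟨∑ i ∈ Finset.range s, Polynomial.C (c i) * (X + Polynomial.C 1) ^ i,
    Submodule.sum_mem _ fun i hi => ?_, fun x => ?_⟩
  · rw [← smul_eq_C_mul]
    exact Submodule.smul_mem _ _ (X_add_one_pow_mem_degreeLT (Finset.mem_range.1 hi))
  · simp [eval_finsetSum, add_comm]

namespace RefIntegrator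

variable {q p : ℕ} {Q : RefIntegrator q} {A : RefApprox p}

theorem map_zero (Q : RefIntegrator q) : Q.toFun (fun _ => 0) = 0 := by
  simpa using Q.map_smul 0 (fun _ => 0) contDiffOn_const

theorem map_sub (Q : RefIntegrator q) {v w : ℝ → ℝ} (hv : ContDiffOn ℝ q v RefIcc)
    (hw : ContDiffOn ℝ q w RefIcc) :
    Q.toFun (fun x => v x - w x) = Q.toFun v - Q.toFun w := by
  have h1 := Q.map_add v (fun x => -1 * w x) hv (contDiffOn_const.mul hw)
  have h2 := Q.map_smul (-1) w hw
  rw [h2] at h1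
  rw [sub_eq_add_neg, ← neg_one_mul, ← h1]
  congr 1
  ext x
  ring

theorem map_sum (Q : RefIntegrator q) {ι : Type*} (s : Finset ι) {v : ι → ℝ → ℝ}
    (hv : ∀ i ∈ s, ContDiffOn ℝ q (v i) RefIcc) :
    Q.toFun (fun x => ∑ i ∈ s, v i x) = ∑ i ∈ s, Q.toFun (v i) := by
  classical
  induction s using Finset.induction_on with
  | empty => simpa using Q.map_zero
  | insert a s ha ih =>
    simp only [Finset.sum_insert ha]
    rw [Q.map_add _ _ (hv a (by simp)) (ContDiffOn.sum fun i hi => hv i (by simp [hi])),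
      ih fun i hi => hv i (by simp [hi])]

theorem integral_eq_of_le_exactSucc {s : ℕ} (hs : (s : ℕ∞) ≤ Q.exactSucc) :
    ∀ φ ∈ degreeLT ℝ s, ∫ x in (-1 : ℝ)..1, φ.eval x = Q.toFun fun x => φ.eval x := by
  refine of_le_iSup_enat (P := fun s => ∀ φ ∈ degreeLT ℝ s,
    ∫ x in (-1 : ℝ)..1, φ.eval x = Q.toFun fun x => φ.eval x) ?_ ?_ hs
  · intro φ hφ
    have : φ = 0 := by simpa [mem_degreeLT, Nat.WithBot.lt_zero_iff] using hφ
    simp [this, Q.map_zero]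
  · exact fun m n hmn h φ hφ => h φ (degreeLT_mono hmn hφ)

theorem _root_.RefApprox.map_zero (A : RefApprox p) :
    Set.EqOn (A.toFun fun _ => 0) (fun _ => 0) RefIcc := by
  simpa using A.map_smul 0 (fun _ => 0) contDiffOn_const

theorem eq_of_le_compatSucc {s i : ℕ} (hs : (s : ℕ∞) ≤ Q.compatSucc A i) :
    ∀ φ ∈ degreeLT ℝ s, ∀ ψ ∈ degreeLT ℝ (i + 1),
      Q.toFun (fun x => φ.eval x * ψ.eval x) =
        Q.toFun (fun x => A.toFun (fun y => φ.eval y) x * ψ.eval x) := by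
  refine of_le_iSup_enat (P := fun s => ∀ φ ∈ degreeLT ℝ s, ∀ ψ ∈ degreeLT ℝ (i + 1),
      Q.toFun (fun x => φ.eval x * ψ.eval x) =
        Q.toFun (fun x => A.toFun (fun y => φ.eval y) x * ψ.eval x)) ?_ ?_ hs
  · intro φ hφ ψ _
    have : φ = 0 := by simpa [mem_degreeLT, Nat.WithBot.lt_zero_iff] using hφ
    subst this
    simp only [eval_zero, zero_mul]
    exact Q.congr _ _ contDiffOn_const fun x hx => by simp [A.map_zero hx]
  · exact fun m n hmn h φ hφ => h φ (degreeLT_mono hmn hφ)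

/-- If `Q[φ ψ] = Q[(A φ) ψ]` for all `φ ∈ P_{s-1}` and all `ψ ∈ P_i`, then `Q[(F - A F) g]` is of
order `h^s` for `g ∈ P_i`. -/
theorem abs_toFun_sub_approx_mul_le {CQ CA : ℝ}
    (hQ : ∀ c v, ScaledBound q 1 c v → |Q.toFun v| ≤ CQ * c)
    (hA : ∀ c v, ScaledBound (max p q) 1 c v → ScaledBound q 1 (CA * c) (A.toFun v))
    {M s i : ℕ} (hpq : max p q ≤ M) (hsM : s ≤ M) (hs : (s : ℕ∞) ≤ Q.compatSucc A i)
    {h C D : ℝ} (h0 : 0 ≤ h) (h1 : h ≤ 1) {F : ℝ → ℝ} (hF : ScaledBound M h C F)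
    {g : ℝ[X]} (hg : g ∈ degreeLT ℝ (i + 1)) (hgD : ScaledBound q 1 D (fun x => g.eval x)) :
    |Q.toFun (fun x => (F x - A.toFun F x) * g.eval x)| ≤
      CQ * (2 ^ q * (2 ^ s * C * h ^ s + CA * (2 ^ s * C * h ^ s)) * D) := by
  obtain ⟨c, -, hrem, -⟩ := hF.taylor h0 h1 hsM
  obtain ⟨T, hT, hTe⟩ := exists_polynomial_eval_eq_sum s c
  simp only [← hTe] at hrem
  set R : ℝ → ℝ := fun x => F x - T.eval x with hR
  have hqM : q ≤ M := (le_max_right _ _).trans hpq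
  have hTc : ∀ n : WithTop ℕ∞, ContDiffOn ℝ n (fun x => T.eval x) RefIcc := fun n =>
    (contDiff_polynomial_eval T n).contDiffOn
  have hgc : ContDiffOn ℝ q (fun x => g.eval x) RefIcc := hgD.1
  have hpM : ContDiffOn ℝ p R RefIcc := (hrem.of_le ((le_max_left _ _).trans hpq)).1
  have hAR := hA _ _ (hrem.of_le hpq)
  have hAT : ContDiffOn ℝ q (A.toFun fun x => T.eval x) RefIcc := A.smooth q _ (hTc _)
  have hsplit : Set.EqOn (A.toFun F) (fun x => A.toFun (fun y => T.eval y) x + A.toFun R x)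
      RefIcc := by
    have := A.map_add (fun y => T.eval y) R (hTc _) hpM
    refine Set.EqOn.trans ?_ this
    refine A.congr _ _ (hF.of_le ((le_max_left _ _).trans hpq)).1 fun x _ => ?_
    simp [hR]
  have e1 : Q.toFun (fun x => (F x - A.toFun F x) * g.eval x) =
      Q.toFun (fun x => (T.eval x * g.eval x - A.toFun (fun y => T.eval y) x * g.eval x) +
        (R x - A.toFun R x) * g.eval x) := by
    refine (Q.congr _ _ ?_ fun x hx => ?_).symm
    · exact (((hTc _).mul hgc).sub (hAT.mul hgc)).add
        (((hrem.of_le hqM).1.sub hAR.1).mul hgc)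
    · rw [hsplit hx]
      simp only [hR]
      ring
  rw [e1, Q.map_add _ _ (((hTc _).mul hgc).sub (hAT.mul hgc))
    (((hrem.of_le hqM).1.sub hAR.1).mul hgc), Q.map_sub ((hTc _).mul hgc) (hAT.mul hgc),
    eq_of_le_compatSucc hs T hT g hg, sub_self, zero_add]
  exact hQ _ _ (((hrem.of_le hqM).sub hAR).mul zero_le_one hgD)

end RefIntegrator

/-! ### The defect on the reference interval -/

/-- The transformed local problem for one component: `F` stands for `f(·, U)`, the polynomial `W`
for `U'` and `J` for `2/h` times the jump of `U` at the left end point, which only occurs for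
`k = 0`. -/
structure RefProblem {q p : ℕ} (r k : ℕ) (Q : RefIntegrator q) (A : RefApprox p)
    (F : ℝ → ℝ) (W : ℝ[X]) (J : ℝ) : Prop where
  deg : W ∈ degreeLT ℝ r
  right : ∀ i < k / 2, iteratedDerivWithin i (fun x => F x - W.eval x) RefIcc 1 = 0
  left : ∀ i < (k - 1) / 2, iteratedDerivWithin i (fun x => F x - W.eval x) RefIcc (-1) = 0
  variational : ∀ g ∈ degreeLT ℝ (r - k + 1),
    Q.toFun (fun x => (F x - W.eval x) * g.eval x) - (if k = 0 then J * g.eval (-1) else 0) =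
      Q.toFun (fun x => (F x - A.toFun F x) * g.eval x)

/-- The weight that removes the jump term from the variational condition for `k = 0`. -/
noncomputable def jumpWeight (k : ℕ) : ℝ[X] := if k = 0 then 1 + X else 1

theorem jumpWeight_mul_mem {r k : ℕ} (hkr : k ≤ r) {i : ℕ} (hi : i < r + 1 - max 1 k) :
    jumpWeight k * X ^ i ∈ degreeLT ℝ (r - k + 1) := by
  rw [mem_degreeLT]
  unfold jumpWeight
  split_ifs with hk
  · subst hk
    have h1 : (1 + X : ℝ[X]).degree = 1 := by
      rw [add_comm]; exact degree_X_add_C (1 : ℝ)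
    rw [degree_mul, degree_X_pow, h1]
    simp only [Nat.sub_zero]
    have : 1 + i < r + 1 := by simp at hi; omega
    exact_mod_cast this
  · rw [one_mul, degree_X_pow]
    have : i < r - k + 1 := by omega
    exact_mod_cast this

/-- The exponent `|⌊(k-1)/2⌋|` of the unisolvence condition is `1` for `k = 0`. -/
theorem natAbs_half_pred (k : ℕ) :
    (((k : ℤ) - 1) / 2).natAbs = if k = 0 then 1 else (k - 1) / 2 := by
  split_ifs with hk
  · subst hk; rfl
  · omega

theorem pow_dvd_of_iterate_derivative_eval_eq_zero {ρ : ℝ[X]} {a : ℝ} {n : ℕ}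
    (h : ∀ i < n, (derivative^[i] ρ).eval a = 0) : (X - Polynomial.C a) ^ n ∣ ρ := by
  rcases eq_or_ne ρ 0 with rfl | h0
  · simp
  rcases n with _ | n
  · simp
  · rw [← le_rootMultiplicity_iff h0]
    exact (lt_rootMultiplicity_iff_isRoot_iterate_derivative h0).2 fun m hm => h m (by omega)

/-- Unisolvence, stated for the conditions of the local problem: end point derivatives together
with the variational condition determine a polynomial of degree less than `r`. -/
theorem eq_zero_of_unisolvent {q r k : ℕ} (hkr : k ≤ r) {Q : RefIntegrator q}
    (hQu : Q.Unisolvent r k) {ρ : ℝ[X]} (hρ : ρ ∈ degreeLT ℝ r)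
    (h1 : ∀ i < k / 2, (derivative^[i] ρ).eval 1 = 0)
    (h2 : ∀ i < (k - 1) / 2, (derivative^[i] ρ).eval (-1) = 0)
    (h3 : ∀ i < r + 1 - max 1 k, Q.toFun (fun x => ρ.eval x * (jumpWeight k * X ^ i).eval x) = 0) :
    ρ = 0 := by
  by_contra hne
  have d1 := pow_dvd_of_iterate_derivative_eval_eq_zero h1
  have d2 := pow_dvd_of_iterate_derivative_eval_eq_zero h2
  have hcop : IsCoprime ((X - Polynomial.C (1 : ℝ)) ^ (k / 2))
      ((X - Polynomial.C (-1 : ℝ)) ^ ((k - 1) / 2)) :=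
    (isCoprime_X_sub_C_of_isUnit_sub (by norm_num)).pow
  obtain ⟨ψ, hψ⟩ := hcop.mul_dvd d1 d2
  have hψ0 : ψ ≠ 0 := by rintro rfl; simp at hψ; exact hne hψ
  have hdeg : ψ ∈ degreeLT ℝ (r + 1 - max 1 k) := by
    rw [mem_degreeLT, ← natDegree_lt_iff_degree_lt hψ0]
    have hρd := (natDegree_lt_iff_degree_lt hne).2 (mem_degreeLT.1 hρ)
    rw [hψ, natDegree_mul (by
      refine mul_ne_zero (pow_ne_zero _ (X_sub_C_ne_zero _)) (pow_ne_zero _ (X_sub_C_ne_zero _)))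
      hψ0, natDegree_mul (pow_ne_zero _ (X_sub_C_ne_zero _)) (pow_ne_zero _ (X_sub_C_ne_zero _)),
      natDegree_pow, natDegree_pow, natDegree_X_sub_C, natDegree_X_sub_C] at hρd
    omega
  refine hψ0 (hQu ψ hdeg fun φ hφ => ?_)
  have hφe : ∀ x, φ.eval x = ∑ i ∈ Finset.range (r + 1 - max 1 k), φ.coeff i * x ^ i := by
    intro x
    rcases eq_or_ne φ 0 with rfl | hφ0
    · simp
    · exact eval_eq_sum_range' ((natDegree_lt_iff_degree_lt hφ0).2 (mem_degreeLT.1 hφ)) x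
  -- The test functions `φ` are spanned by monomials; the factor `(-1)^⌊k/2⌋` comes from `1 - x`
  -- in place of `x - 1`.
  have hfun : (fun x : ℝ => (1 - x) ^ (k / 2) * (1 + x) ^ (((k : ℤ) - 1) / 2).natAbs *
        ψ.eval x * φ.eval x) = fun x => ∑ i ∈ Finset.range (r + 1 - max 1 k),
          ((-1) ^ (k / 2) * φ.coeff i) * (ρ.eval x * (jumpWeight k * X ^ i).eval x) := by
    ext x
    have e1 : (1 - x) ^ (k / 2) = (-1) ^ (k / 2) * (x - 1) ^ (k / 2) := by
      rw [← mul_pow]; congr 1; ring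
    have e2 : (1 + x) ^ (((k : ℤ) - 1) / 2).natAbs =
        (x + 1) ^ ((k - 1) / 2) * (jumpWeight k).eval x := by
      rw [natAbs_half_pred]
      unfold jumpWeight
      split_ifs with hk
      · subst hk; simp
      · simp [add_comm]
    rw [e1, e2, hφe, Finset.mul_sum, hψ]
    refine Finset.sum_congr rfl fun i _ => ?_
    simp
    ring
  have hc : ∀ i, ContDiffOn ℝ q (fun x => ρ.eval x * (jumpWeight k * X ^ i).eval x) RefIcc :=
    fun i => ((contDiff_polynomial_eval _ _).mul (contDiff_polynomial_eval _ _)).contDiffOn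
  rw [hfun, Q.map_sum _ fun i _ => contDiffOn_const.mul (hc i)]
  refine Finset.sum_eq_zero fun i hi => ?_
  rw [Q.map_smul _ _ (hc i), h3 i (Finset.mem_range.1 hi), mul_zero]

/-- The quantitative form of unisolvence. -/
theorem exists_coeff_bound_of_unisolvent {q r k : ℕ} (hkr : k ≤ r) {Q : RefIntegrator q}
    (hQu : Q.Unisolvent r k) : ∃ K : ℝ, 0 ≤ K ∧ ∀ ρ ∈ degreeLT ℝ r, ∀ c : ℝ, 0 ≤ c →
      (∀ i < k / 2, |(derivative^[i] ρ).eval 1| ≤ c) →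
      (∀ i < (k - 1) / 2, |(derivative^[i] ρ).eval (-1)| ≤ c) →
      (∀ i < r + 1 - max 1 k,
        |Q.toFun (fun x => ρ.eval x * (jumpWeight k * X ^ i).eval x)| ≤ c) →
      ∀ i < r, |ρ.coeff i| ≤ K * c := by
  have hc : ∀ (ρ : ℝ[X]) (i : ℕ),
      ContDiffOn ℝ q (fun x => ρ.eval x * (jumpWeight k * X ^ i).eval x) RefIcc :=
    fun ρ i => ((contDiff_polynomial_eval _ _).mul (contDiff_polynomial_eval _ _)).contDiffOn
  -- `L` collects the end point derivatives and the weighted moments; it is injective on `P_{r-1}`.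
  let L1 : ℝ → ℕ → ℝ[X] →ₗ[ℝ] ℝ := fun a i => (Polynomial.leval a).comp (derivative ^ i)
  let L3 : ℕ → ℝ[X] →ₗ[ℝ] ℝ := fun i =>
    { toFun := fun ρ => Q.toFun (fun x => ρ.eval x * (jumpWeight k * X ^ i).eval x)
      map_add' := fun ρ ρ' => by
        rw [← Q.map_add _ _ (hc ρ i) (hc ρ' i)]
        congr 1; ext x; rw [eval_add]; ring
      map_smul' := fun a ρ => by
        rw [RingHom.id_apply, smul_eq_mul, ← Q.map_smul a _ (hc ρ i)]
        congr 1; ext x; rw [eval_smul, smul_eq_mul]; ring }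
  let L : ℝ[X] →ₗ[ℝ] (Fin (k / 2) ⊕ Fin ((k - 1) / 2) ⊕ Fin (r + 1 - max 1 k) → ℝ) :=
    LinearMap.pi (Sum.elim (fun i => L1 1 i) (Sum.elim (fun i => L1 (-1) i) fun i => L3 i))
  have hL1 : ∀ a i ρ, L1 a i ρ = (derivative^[i] ρ).eval a := fun a i ρ => by
    simp [L1, Module.End.pow_apply]
  let Λ := (L.comp (degreeLT ℝ r).subtype).comp (degreeLTEquiv ℝ r).symm.toLinearMap
  have hker : LinearMap.ker Λ = ⊥ := by
    rw [LinearMap.ker_eq_bot']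
    intro x hx
    have hx' : L ((degreeLTEquiv ℝ r).symm x : ℝ[X]) = 0 := hx
    have h0 := eq_zero_of_unisolvent hkr hQu ((degreeLTEquiv ℝ r).symm x).2
      (fun i hi => by rw [← hL1]; exact congrFun hx' (Sum.inl ⟨i, hi⟩))
      (fun i hi => by rw [← hL1]; exact congrFun hx' (Sum.inr (Sum.inl ⟨i, hi⟩)))
      (fun i hi => congrFun hx' (Sum.inr (Sum.inr ⟨i, hi⟩)))
    have h0' : (degreeLTEquiv ℝ r).symm x = 0 := Subtype.ext h0
    simpa using h0'
  obtain ⟨K, -, hK⟩ := LinearMap.exists_antilipschitzWith Λ hker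
  refine ⟨K, K.2, fun ρ hρ c hc0 h1 h2 h3 i hi => ?_⟩
  have hle := hK.le_mul_dist (degreeLTEquiv ℝ r ⟨ρ, hρ⟩) 0
  rw [dist_zero_right, LinearMap.map_zero, dist_zero_right] at hle
  have hcoef : |ρ.coeff i| ≤ ‖degreeLTEquiv ℝ r ⟨ρ, hρ⟩‖ :=
    norm_le_pi_norm (degreeLTEquiv ℝ r ⟨ρ, hρ⟩) ⟨i, hi⟩
  have hΛ : Λ (degreeLTEquiv ℝ r ⟨ρ, hρ⟩) = L ρ := by simp [Λ]
  have hn : ‖Λ (degreeLTEquiv ℝ r ⟨ρ, hρ⟩)‖ ≤ c := by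
    rw [hΛ, pi_norm_le_iff_of_nonneg hc0]
    rintro (j | j | j)
    · change |L1 1 j ρ| ≤ c; rw [hL1]; exact h1 j j.2
    · change |L1 (-1) j ρ| ≤ c; rw [hL1]; exact h2 j j.2
    · exact h3 j j.2
  exact hcoef.trans (hle.trans (mul_le_mul_of_nonneg_left hn K.2))

theorem jumpWeight_eval_neg_one {k : ℕ} (hk : k = 0) (i : ℕ) :
    (jumpWeight k * X ^ i).eval (-1) = 0 := by
  simp [jumpWeight, hk]

theorem ScaledBound.exists_polynomial (M : ℕ) (g : ℝ[X]) :
    ∃ D : ℝ, 0 ≤ D ∧ ScaledBound M 1 D (fun x => g.eval x) := by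
  obtain ⟨D, hD, h⟩ := ScaledBound.polynomial M (g.natDegree + 1)
  have hg : g ∈ degreeLT ℝ (g.natDegree + 1) := by
    rw [mem_degreeLT]
    exact degree_le_natDegree.trans_lt (by exact_mod_cast Nat.lt_succ_self _)
  have hs : 0 ≤ ∑ i ∈ Finset.range (g.natDegree + 1), |g.coeff i| :=
    Finset.sum_nonneg fun i _ => abs_nonneg _
  exact ⟨_, by positivity, h g _ hg (fun i hi =>
    Finset.single_le_sum (f := fun i => |g.coeff i|) (fun i _ => abs_nonneg _)
      (Finset.mem_range.2 hi)) hs⟩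

/-- The defect `F - W` of the local problem is of order `h^s` in `C^M`. -/
theorem RefProblem.exists_scaledBound_defect {q p r k : ℕ} (hkr : k ≤ r) {Q : RefIntegrator q}
    {A : RefApprox p} (hQu : Q.Unisolvent r k) {CQ CA : ℝ} (hCQ : 0 ≤ CQ) (hCA : 0 ≤ CA)
    (hQ : ∀ c v, ScaledBound q 1 c v → |Q.toFun v| ≤ CQ * c)
    (hA : ∀ c v, ScaledBound (max p q) 1 c v → ScaledBound q 1 (CA * c) (A.toFun v))
    {M s : ℕ} (hpq : max p q ≤ M) (hrM : r ≤ M) (hsr : s ≤ r)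
    (hs : (s : ℕ∞) ≤ Q.compatSucc A (r - k)) {C : ℝ} (hC : 0 ≤ C) :
    ∃ K : ℝ, 0 ≤ K ∧ ∀ (h : ℝ) (F : ℝ → ℝ) (W : ℝ[X]) (J : ℝ), 0 ≤ h → h ≤ 1 →
      ScaledBound M h C F → RefProblem r k Q A F W J →
      ScaledBound M 1 (K * h ^ s) (fun x => F x - W.eval x) := by
  have hsM : s ≤ M := hsr.trans hrM
  have hqM : q ≤ M := (le_max_right _ _).trans hpq
  obtain ⟨K1, hK1, hcoef⟩ := exists_coeff_bound_of_unisolvent hkr hQu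
  obtain ⟨K2, hK2, hpoly⟩ := ScaledBound.polynomial M r
  choose D hD hgD using fun i => ScaledBound.exists_polynomial q (jumpWeight k * X ^ i)
  set S : ℝ := ∑ i ∈ Finset.range (r + 1 - max 1 k), D i with hS
  have hS0 : 0 ≤ S := Finset.sum_nonneg fun i _ => hD i
  set B : ℝ := 2 ^ s * C with hB
  have hB0 : 0 ≤ B := by positivity
  set B' : ℝ := B + CQ * (2 ^ q * (B + CA * B) * S) + CQ * (2 ^ q * B * S) with hB'
  have hB'0 : 0 ≤ B' := by positivity
  refine ⟨B + K2 * (K1 * B'), by positivity, fun h F W J h0 h1 hF hP => ?_⟩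
  obtain ⟨c, -, hrem, -⟩ := hF.taylor h0 h1 hsM
  obtain ⟨T, hT, hTe⟩ := exists_polynomial_eval_eq_sum s c
  simp only [← hTe] at hrem
  set R : ℝ → ℝ := fun x => F x - T.eval x with hR
  have hρ : T - W ∈ degreeLT ℝ r := Submodule.sub_mem _ (degreeLT_mono hsr hT) hP.deg
  have hFW : ContDiffOn ℝ M (fun x => F x - W.eval x) RefIcc :=
    hF.1.sub (contDiff_polynomial_eval _ _).contDiffOn
  have hρR : Set.EqOn (fun x => (T - W).eval x) (fun x => (F x - W.eval x) - R x) RefIcc := by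
    intro x _
    simp [hR]
  have hend : ∀ i ≤ M, ∀ x ∈ RefIcc,
      iteratedDerivWithin i (fun x => F x - W.eval x) RefIcc x = 0 →
      |(derivative^[i] (T - W)).eval x| ≤ B' * h ^ s := by
    intro i hi x hx h'
    rw [← iteratedDerivWithin_polynomial _ _ hx, iteratedDerivWithin_congr hρR hx]
    have hi' : (i : WithTop ℕ∞) ≤ M := by exact_mod_cast hi
    have hsub := iteratedDerivWithin_sub (n := i) hx uniqueDiffOn_refIcc
      ((hFW x hx).of_le hi') ((hrem.1 x hx).of_le hi')
    change iteratedDerivWithin i (fun x => (F x - W.eval x) - R x) RefIcc x = _ at hsub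
    rw [hsub, h', zero_sub, abs_neg]
    refine (hrem.2 i hi x hx).trans ?_
    rw [one_pow, mul_one]
    refine mul_le_mul_of_nonneg_right ?_ (by positivity)
    rw [hB', add_assoc]
    exact le_add_of_nonneg_right (by positivity)
  have hvar : ∀ i < r + 1 - max 1 k,
      |Q.toFun (fun x => (T - W).eval x * (jumpWeight k * X ^ i).eval x)| ≤ B' * h ^ s := by
    intro i hi
    have hDS : D i ≤ S := Finset.single_le_sum (f := D) (fun i _ => hD i) (Finset.mem_range.2 hi)
    have hmem := jumpWeight_mul_mem hkr hi
    have e1 : Q.toFun (fun x => (T - W).eval x * (jumpWeight k * X ^ i).eval x) =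
        Q.toFun (fun x => (F x - W.eval x) * (jumpWeight k * X ^ i).eval x) -
          Q.toFun (fun x => R x * (jumpWeight k * X ^ i).eval x) := by
      rw [← Q.map_sub ((hFW.of_le (by exact_mod_cast hqM)).mul (hgD i).1)
        ((hrem.of_le hqM).1.mul (hgD i).1)]
      congr 1
      ext x
      simp only [hR, eval_sub]
      ring
    have e2 := hP.variational _ hmem
    have e3 : (if k = 0 then J * (jumpWeight k * X ^ i).eval (-1) else 0) = 0 := by
      split_ifs with hk
      · rw [jumpWeight_eval_neg_one hk, mul_zero]
      · rfl
    rw [e3, sub_zero] at e2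
    rw [e1, e2]
    have b1 := RefIntegrator.abs_toFun_sub_approx_mul_le hQ hA hpq hsM hs h0 h1 hF hmem (hgD i)
    have b2 := hQ _ _ ((hrem.of_le hqM).mul zero_le_one (hgD i))
    refine (abs_sub _ _).trans ((add_le_add b1 b2).trans ?_)
    have hh : 0 ≤ h ^ s := by positivity
    calc _ = (CQ * (2 ^ q * (B + CA * B) * D i) + CQ * (2 ^ q * B * D i)) * h ^ s := by
          rw [hB]; ring
      _ ≤ (CQ * (2 ^ q * (B + CA * B) * S) + CQ * (2 ^ q * B * S)) * h ^ s := by gcongr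
      _ ≤ _ := by
          refine mul_le_mul_of_nonneg_right ?_ hh
          rw [hB', add_assoc]
          exact le_add_of_nonneg_left hB0
  have hco := hcoef _ hρ (B' * h ^ s) (by positivity)
    (fun i hi => hend i (by omega) 1 (by simp) (hP.right i hi))
    (fun i hi => hend i (by omega) (-1) (by simp) (hP.left i hi)) hvar
  have hfin := hrem.add (hpoly _ _ hρ hco (by positivity))
  refine (hfin.congr fun x _ => ?_).mono zero_le_one (le_of_eq ?_)
  · simp [hR]
  · rw [hB]; ring

/-- The defect functional of the local problem is of order `h^σ`. -/
theorem RefProblem.exists_abs_defect_functional_le {q p r k : ℕ} (hkr : k ≤ r)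
    {Q : RefIntegrator q} {A : RefApprox p} (hQu : Q.Unisolvent r k) {CQ CA : ℝ} (hCQ : 0 ≤ CQ)
    (hCA : 0 ≤ CA) (hQ : ∀ c v, ScaledBound q 1 c v → |Q.toFun v| ≤ CQ * c)
    (hA : ∀ c v, ScaledBound (max p q) 1 c v → ScaledBound q 1 (CA * c) (A.toFun v))
    {M σ : ℕ} (hpq : max p q ≤ M) (hrM : r + 1 ≤ M) (hσM : σ ≤ M)
    (hσ1 : σ ≤ 2 * r - k + 1) (hσ2 : ∀ i ≤ r - k, (σ : ℕ∞) ≤ Q.compatSucc A i + i)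
    (hσ3 : (σ : ℕ∞) ≤ Q.exactSucc ∨ (σ : ℕ∞) ≤ min (r : ℕ∞) (Q.compatSucc A (r - k)))
    {C : ℝ} (hC : 0 ≤ C) :
    ∃ K : ℝ, 0 ≤ K ∧ ∀ (h : ℝ) (F z : ℝ → ℝ) (W : ℝ[X]) (J : ℝ), 0 ≤ h → h ≤ 1 →
      ScaledBound M h C F → ScaledBound M h C (fun x => W.eval x) → ScaledBound M h C z →
      RefProblem r k Q A F W J →
      |(∫ x in (-1 : ℝ)..1, (F x - W.eval x) * z x) - (if k = 0 then J * z (-1) else 0)| ≤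
        K * h ^ σ := by
  have hqM : q ≤ M := (le_max_right _ _).trans hpq
  have hint : ∀ c (v : ℝ → ℝ), (∀ x ∈ RefIcc, ‖v x‖ ≤ c) → |∫ x in (-1 : ℝ)..1, v x| ≤ 2 * c := by
    intro c v hv
    have := intervalIntegral.norm_integral_le_of_norm_le_const (a := -1) (b := 1) (f := v) (C := c)
      (fun x hx => hv x (Set.Ioc_subset_Icc_self (by rwa [Set.uIoc_of_le (by norm_num)] at hx)))
    rw [Real.norm_eq_abs] at this
    refine this.trans (le_of_eq ?_)
    norm_num
    ring
  rcases hσ3 with hex | hmin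
  · -- The integral may be replaced by `Q`, and `z` is split into a polynomial and a remainder.
    -- The order of the defect that is needed to reach `σ` together with `z - φ = O(h^{r-k+1})`.
    set s : ℕ := min r (σ - (r - k + 1)) with hs
    have hsc : (s : ℕ∞) ≤ Q.compatSucc A (r - k) := by
      have h1 := hσ2 (r - k) le_rfl
      have h2 : ((σ - (r - k) : ℕ) : ℕ∞) ≤ Q.compatSucc A (r - k) := by
        push_cast
        exact tsub_le_iff_right.2 (by push_cast at h1; exact h1)
      refine le_trans ?_ h2
      have : s ≤ σ - (r - k) := by omega
      exact_mod_cast this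
    obtain ⟨K1, hK1, hR⟩ := RefProblem.exists_scaledBound_defect hkr hQu hCQ hCA hQ hA hpq
      (M := M) (by omega) (min_le_left r _) hsc hC
    choose D hD hgD using fun i => ScaledBound.exists_polynomial q ((X + Polynomial.C 1 : ℝ[X]) ^ i)
    -- `E1` bounds the Taylor remainder of `(F - W) z`, `E2` the term `Q[(F - W) (z - φ)]` and `E3`
    -- the term `Q[(F - A F) φ]`, where `φ` is the Taylor polynomial of `z`.
    set E1 : ℝ := 2 ^ σ * (2 ^ M * (C + C) * C) with hE1
    set E2 : ℝ := CQ * (2 ^ q * K1 * (2 ^ (r - k + 1) * C)) with hE2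
    set E3 : ℝ := ∑ i ∈ Finset.range (r - k + 1),
      C * (CQ * (2 ^ q * (2 ^ (σ - i) * C + CA * (2 ^ (σ - i) * C)) * D i)) with hE3
    have hE30 : 0 ≤ E3 := Finset.sum_nonneg fun i _ => by have := hD i; positivity
    refine ⟨2 * E1 + CQ * E1 + E2 + E3, by positivity, fun h F z W J h0 h1 hF hW hz hP => ?_⟩
    have hσh : ∀ n, σ ≤ n → h ^ n ≤ h ^ σ := fun n hn => pow_le_pow_of_le_one h0 h1 hn
    have hRs := hR h F W J h0 h1 hF hP
    have hRq := hRs.of_le hqM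
    obtain ⟨c, hc, hzrem, hz1⟩ := hz.taylor h0 h1 (s := r - k + 1) (by omega)
    obtain ⟨φ, hφ, hφe⟩ := exists_polynomial_eval_eq_sum (r - k + 1) c
    have hz1' := hz1 (by omega)
    simp only [← hφe] at hzrem hz1'
    have hRz := (hF.sub hW).mul h0 hz
    obtain ⟨c', -, hrem', -⟩ := hRz.taylor h0 h1 hσM
    obtain ⟨T, hT, hTe⟩ := exists_polynomial_eval_eq_sum σ c'
    simp only [← hTe] at hrem'
    have hTc : ContDiffOn ℝ q (fun x => T.eval x) RefIcc :=
      (contDiff_polynomial_eval _ _).contDiffOn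
    have hφc : ContDiffOn ℝ q (fun x => φ.eval x) RefIcc :=
      (contDiff_polynomial_eval _ _).contDiffOn
    have huI : Set.uIcc (-1 : ℝ) 1 = RefIcc := Set.uIcc_of_le (by norm_num)
    have q1 : ∫ x in (-1 : ℝ)..1, (F x - W.eval x) * z x =
        (∫ x in (-1 : ℝ)..1, ((F x - W.eval x) * z x - T.eval x)) + Q.toFun (fun x => T.eval x) := by
      rw [← Q.integral_eq_of_le_exactSucc hex T hT, ← intervalIntegral.integral_add]
      · simp
      · refine ContinuousOn.intervalIntegrable ?_
        rw [huI]
        exact hrem'.continuousOn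
      · exact (contDiff_polynomial_eval T 0).continuous.intervalIntegrable _ _
    have q2 : Q.toFun (fun x => (F x - W.eval x) * z x) =
        Q.toFun (fun x => (F x - W.eval x) * z x - T.eval x) + Q.toFun (fun x => T.eval x) := by
      rw [← Q.map_add _ _ (hrem'.of_le hqM).1 hTc]
      simp
    have q3 : Q.toFun (fun x => (F x - W.eval x) * z x) =
        Q.toFun (fun x => (F x - W.eval x) * (z x - φ.eval x)) +
          Q.toFun (fun x => (F x - W.eval x) * φ.eval x) := by
      rw [← Q.map_add _ _ (hRq.1.mul (hzrem.of_le hqM).1) (hRq.1.mul hφc)]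
      congr 1; ext x; ring
    have q4 := hP.variational φ hφ
    rw [← hz1'] at q4
    have q5 : Q.toFun (fun x => (F x - A.toFun F x) * φ.eval x) =
        ∑ i ∈ Finset.range (r - k + 1),
          c i * Q.toFun (fun x => (F x - A.toFun F x) * ((X + Polynomial.C 1 : ℝ[X]) ^ i).eval x) := by
      have hFA := (((hF.to_one h0 h1).of_le hqM).sub
        (hA _ _ ((hF.to_one h0 h1).of_le hpq))).1
      have hci : ∀ i, ContDiffOn ℝ q
          (fun x => (F x - A.toFun F x) * ((X + Polynomial.C 1 : ℝ[X]) ^ i).eval x) RefIcc := fun i =>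
        hFA.mul (hgD i).1
      rw [← Finset.sum_congr rfl fun i _ => Q.map_smul (c i) _ (hci i),
        ← Q.map_sum _ fun i _ => contDiffOn_const.mul (hci i)]
      congr 1; ext x
      rw [hφe, Finset.mul_sum]
      refine Finset.sum_congr rfl fun i _ => ?_
      simp
      ring
    have b1 : |∫ x in (-1 : ℝ)..1, ((F x - W.eval x) * z x - T.eval x)| ≤ 2 * (E1 * h ^ σ) :=
      hint _ _ fun x hx => hrem'.norm_le hx
    have b2 : |Q.toFun (fun x => (F x - W.eval x) * z x - T.eval x)| ≤ CQ * (E1 * h ^ σ) :=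
      hQ _ _ (hrem'.of_le hqM)
    have b3 : |Q.toFun (fun x => (F x - W.eval x) * (z x - φ.eval x))| ≤ E2 * h ^ σ := by
      refine (hQ _ _ (hRq.mul zero_le_one (hzrem.of_le hqM))).trans ?_
      calc _ = E2 * h ^ (s + (r - k + 1)) := by rw [hE2, pow_add]; ring
        _ ≤ E2 * h ^ σ := mul_le_mul_of_nonneg_left (hσh _ (by omega)) (by positivity)
    have b4 : |Q.toFun (fun x => (F x - A.toFun F x) * φ.eval x)| ≤ E3 * h ^ σ := by
      rw [q5, hE3, Finset.sum_mul]
      refine (Finset.abs_sum_le_sum_abs _ _).trans (Finset.sum_le_sum fun i hi => ?_)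
      have hi' := Finset.mem_range.1 hi
      have hDi := hD i
      have hsi : ((σ - i : ℕ) : ℕ∞) ≤ Q.compatSucc A i := by
        push_cast
        exact tsub_le_iff_right.2 (hσ2 i (by omega))
      have := RefIntegrator.abs_toFun_sub_approx_mul_le hQ hA hpq (M := M) (by omega) hsi h0 h1
        hF (X_add_one_pow_mem_degreeLT (Nat.lt_succ_self i)) (hgD i)
      rw [abs_mul]
      refine (mul_le_mul (hc i hi') this (abs_nonneg _) (by positivity)).trans ?_
      calc _ = C * (CQ * (2 ^ q * (2 ^ (σ - i) * C + CA * (2 ^ (σ - i) * C)) * D i)) *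
            h ^ (i + (σ - i)) := by rw [pow_add]; ring
        _ ≤ _ := mul_le_mul_of_nonneg_left (hσh _ (by omega)) (by positivity)
    have hfinal : (∫ x in (-1 : ℝ)..1, (F x - W.eval x) * z x) - (if k = 0 then J * z (-1) else 0) =
        (∫ x in (-1 : ℝ)..1, ((F x - W.eval x) * z x - T.eval x)) -
          Q.toFun (fun x => (F x - W.eval x) * z x - T.eval x) +
          Q.toFun (fun x => (F x - W.eval x) * (z x - φ.eval x)) +
          Q.toFun (fun x => (F x - A.toFun F x) * φ.eval x) := by
      rw [q1, ← q4]
      linarith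
    rw [hfinal]
    have := abs_le.1 b1
    have := abs_le.1 b2
    have := abs_le.1 b3
    have := abs_le.1 b4
    rw [abs_le]
    constructor <;> linarith
  · -- The defect itself is of order `h^σ`.
    rw [le_min_iff] at hmin
    have hσr : σ ≤ r := by exact_mod_cast hmin.1
    obtain ⟨K1, hK1, hR⟩ := RefProblem.exists_scaledBound_defect hkr hQu hCQ hCA hQ hA hpq
      (M := M) (by omega) hσr hmin.2 hC
    obtain ⟨D, hD, hgD⟩ := ScaledBound.exists_polynomial q (1 : ℝ[X])
    set E : ℝ := CQ * (2 ^ q * K1 * D) +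
      CQ * (2 ^ q * (2 ^ σ * C + CA * (2 ^ σ * C)) * D) with hE
    have hE0 : 0 ≤ E := by positivity
    refine ⟨2 * (K1 * C) + E * C, by positivity, fun h F z W J h0 h1 hF hW hz hP => ?_⟩
    have hRs := hR h F W J h0 h1 hF hP
    have hh : 0 ≤ h ^ σ := by positivity
    have b1 : |∫ x in (-1 : ℝ)..1, (F x - W.eval x) * z x| ≤ 2 * (K1 * h ^ σ * C) := by
      refine hint _ _ fun x hx => ?_
      rw [norm_mul]
      exact mul_le_mul (hRs.norm_le hx) (hz.norm_le hx) (norm_nonneg _) (by positivity)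
    -- The jump is bounded by testing with the constant `1`.
    have b2 : |if k = 0 then J * z (-1) else 0| ≤ E * h ^ σ * C := by
      split_ifs with hk
      · have hmem : (1 : ℝ[X]) ∈ degreeLT ℝ (r - k + 1) := by
          rw [mem_degreeLT, degree_one]
          exact_mod_cast Nat.succ_pos _
        have e := hP.variational 1 hmem
        rw [if_pos hk, eval_one, mul_one] at e
        have c1 := hQ _ _ ((hRs.of_le hqM).mul zero_le_one hgD)
        have c2 := RefIntegrator.abs_toFun_sub_approx_mul_le hQ hA hpq (M := M) hσM hmin.2 h0 h1
          hF hmem hgD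
        have hJ : |J| ≤ E * h ^ σ := by
          rw [abs_le] at c1 c2 ⊢
          rw [hE]
          constructor <;> nlinarith
        rw [abs_mul]
        exact mul_le_mul hJ (hz.norm_le (by simp)) (abs_nonneg _) (by positivity)
      · simp only [abs_zero]
        positivity
    refine (abs_sub _ _).trans ((add_le_add b1 b2).trans (le_of_eq ?_))
    ring

/-! ### Scalar consequences of the stability assumptions -/

theorem ScaledBound.sum_supNormOn_le {E : Type*} [NormedAddCommGroup E] [NormedSpace ℝ E] {M : ℕ}
    {c : ℝ} {φ : ℝ → E} (hφ : ScaledBound M 1 c φ) :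
    ∑ j ∈ Finset.range (M + 1), supNormOn RefIcc (iteratedDerivWithin j φ RefIcc) ≤
      (M + 1) * c := by
  have : ∀ j ∈ Finset.range (M + 1),
      supNormOn RefIcc (iteratedDerivWithin j φ RefIcc) ≤ c := by
    intro j hj
    refine csSup_le ⟨_, Set.mem_image_of_mem _ (show (0 : ℝ) ∈ RefIcc by simp)⟩ ?_
    rintro _ ⟨x, hx, rfl⟩
    simpa using hφ.2 j (by simpa [Nat.lt_succ_iff] using hj) x hx
  refine (Finset.sum_le_card_nsmul _ _ _ this).trans (le_of_eq ?_)
  simp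

/-- A scalar function is turned into a vector valued one with a single nonzero component, to which
the vector valued stability assumptions apply. -/
theorem ScaledBound.smul_single {d M : ℕ} {c : ℝ} {v : ℝ → ℝ} (hv : ScaledBound M 1 c v)
    (j : Fin d) :
    ScaledBound M 1 c (fun x => v x • (EuclideanSpace.single j (1 : ℝ) : Vec d)) := by
  have := hv.clm (ContinuousLinearMap.toSpanSingleton ℝ (EuclideanSpace.single j (1 : ℝ) : Vec d))
  simpa [ContinuousLinearMap.norm_toSpanSingleton] using this

theorem RefIntegrator.Stable.exists_scalar {q d : ℕ} {Q : RefIntegrator q} (hQ : Q.Stable d)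
    (j : Fin d) :
    ∃ CQ : ℝ, 0 ≤ CQ ∧ ∀ c v, ScaledBound q 1 c v → |Q.toFun v| ≤ CQ * c := by
  obtain ⟨C, hC⟩ := hQ
  refine ⟨|C| * (q + 1), by positivity, fun c v hv => ?_⟩
  have hφ := hv.smul_single j
  have h1 := hC _ hφ.1
  have h2 : |Q.toFun v| ≤ ‖Q.vec fun x => v x • (EuclideanSpace.single j (1 : ℝ) : Vec d)‖ := by
    have := PiLp.norm_apply_le (Q.vec fun x => v x • (EuclideanSpace.single j (1 : ℝ) : Vec d)) j
    simpa [RefIntegrator.vec] using this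
  refine h2.trans (h1.trans ?_)
  rw [mul_assoc]
  refine (mul_le_mul_of_nonneg_right (le_abs_self C) ?_).trans
    (mul_le_mul_of_nonneg_left hφ.sum_supNormOn_le (abs_nonneg _))
  exact Finset.sum_nonneg fun i _ => Real.sSup_nonneg (by rintro _ ⟨x, _, rfl⟩; positivity)

theorem RefApprox.Stable.exists_scalar {p q d : ℕ} {A : RefApprox p} (hA : A.Stable d q)
    (j : Fin d) :
    ∃ CA : ℝ, 0 ≤ CA ∧
      ∀ c v, ScaledBound (max p q) 1 c v → ScaledBound q 1 (CA * c) (A.toFun v) := by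
  obtain ⟨C, hC⟩ := hA
  refine ⟨|C| * ((max p q : ℕ) + 1), by positivity, fun c v hv => ?_⟩
  have hφ := hv.smul_single j
  have hc := hv.nonneg
  set φ : ℝ → Vec d := fun x => v x • (EuclideanSpace.single j (1 : ℝ) : Vec d) with hφdef
  have hcd : ContDiffOn ℝ q (A.vec φ) RefIcc := by
    rw [contDiffOn_euclidean]
    intro i
    refine A.smooth q _ ?_
    exact (contDiffOn_euclidean.1 hφ.1) i
  have hvec : ScaledBound q 1 (|C| * ((max p q : ℕ) + 1) * c) (A.vec φ) := by
    refine ⟨hcd, fun l hl x hx => ?_⟩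
    have hφl := hφ.of_le (max_le_max le_rfl hl : max p l ≤ max p q)
    have h1 := hC l hl φ hφl.1
    have hbdd : BddAbove ((fun t => ‖iteratedDerivWithin l (A.vec φ) RefIcc t‖) '' RefIcc) :=
      isCompact_Icc.bddAbove_image (hcd.continuousOn_iteratedDerivWithin
        (by exact_mod_cast hl) uniqueDiffOn_refIcc).norm
    have h2 : ‖iteratedDerivWithin l (A.vec φ) RefIcc x‖ ≤
        supNormOn RefIcc (iteratedDerivWithin l (A.vec φ) RefIcc) :=
      le_csSup hbdd (Set.mem_image_of_mem _ hx)
    refine h2.trans (h1.trans ?_)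
    rw [one_pow, mul_one, mul_assoc]
    refine (mul_le_mul_of_nonneg_right (le_abs_self C) ?_).trans
      (mul_le_mul_of_nonneg_left (hφl.sum_supNormOn_le.trans ?_) (abs_nonneg _))
    · exact Finset.sum_nonneg fun i _ => Real.sSup_nonneg (by rintro _ ⟨x, _, rfl⟩; positivity)
    · have : ((max p l : ℕ) : ℝ) ≤ (max p q : ℕ) := by
        exact_mod_cast (max_le_max le_rfl hl : max p l ≤ max p q)
      gcongr
  have hproj := hvec.clm (EuclideanSpace.proj j : Vec d →L[ℝ] ℝ)
  have hle : ‖(EuclideanSpace.proj j : Vec d →L[ℝ] ℝ)‖ ≤ 1 :=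
    ContinuousLinearMap.opNorm_le_bound _ zero_le_one fun x => by
      simpa using PiLp.norm_apply_le x j
  refine (hproj.mono zero_le_one (mul_le_of_le_one_left hvec.nonneg hle)).congr fun x _ => ?_
  simp [RefApprox.vec, hφdef]

/-! ### Transformation to the reference interval -/

theorem fromRef_mem {a b x : ℝ} (hab : a < b) (hx : x ∈ RefIcc) :
    fromRef a b x ∈ Set.Icc a b := by
  unfold fromRef
  obtain ⟨h1, h2⟩ := hx
  constructor <;> nlinarith

theorem fromRef_mem_Ioc {a b x : ℝ} (hab : a < b) (hx : x ∈ Set.Ioc (-1 : ℝ) 1) :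
    fromRef a b x ∈ Set.Ioc a b := by
  unfold fromRef
  obtain ⟨h1, h2⟩ := hx
  constructor <;> nlinarith

theorem fromRef_one (a b : ℝ) : fromRef a b 1 = b := by unfold fromRef; ring

theorem fromRef_neg_one (a b : ℝ) : fromRef a b (-1) = a := by unfold fromRef; ring

theorem toRef_fromRef {a b : ℝ} (hab : a < b) (x : ℝ) : toRef a b (fromRef a b x) = x := by
  have : b - a ≠ 0 := by linarith
  unfold toRef fromRef
  field_simp
  ring

theorem toRef_left {a b : ℝ} (hab : a < b) : toRef a b a = -1 := by
  have := toRef_fromRef hab (-1)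
  rwa [fromRef_neg_one] at this

theorem hasDerivAt_fromRef (a b x : ℝ) : HasDerivAt (fromRef a b) ((b - a) / 2) x := by
  have := ((hasDerivAt_id' x).const_mul ((b - a) / 2)).const_add ((a + b) / 2)
  rw [mul_one] at this
  exact this

section Transform

variable {E : Type*} [NormedAddCommGroup E] [NormedSpace ℝ E]

theorem hasDerivWithinAt_comp_fromRef {a b : ℝ} (hab : a < b) {g : ℝ → E} {g' : E} {x : ℝ}
    (hg : HasDerivWithinAt g g' (Set.Icc a b) (fromRef a b x)) :
    HasDerivWithinAt (fun x => g (fromRef a b x)) (((b - a) / 2) • g') RefIcc x :=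
  hg.scomp x (hasDerivAt_fromRef a b x).hasDerivWithinAt fun _ hy => fromRef_mem hab hy

theorem iteratedDerivWithin_comp_fromRef {a b : ℝ} (hab : a < b) {g : ℝ → E} {n i : ℕ}
    (hg : ContDiffOn ℝ n g (Set.Icc a b)) (hi : i ≤ n) {x : ℝ} (hx : x ∈ RefIcc) :
    iteratedDerivWithin i (fun x => g (fromRef a b x)) RefIcc x =
      ((b - a) / 2) ^ i • iteratedDerivWithin i g (Set.Icc a b) (fromRef a b x) := by
  induction i generalizing x with
  | zero => simp
  | succ i ih =>
    have hud := uniqueDiffOn_Icc hab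
    rw [iteratedDerivWithin_succ, derivWithin_congr (fun y hy => ih (by omega) hy)
      (ih (by omega) hx), iteratedDerivWithin_succ]
    have hd := (hg.differentiableOn_iteratedDerivWithin (m := i)
      (by exact_mod_cast (by omega)) hud _ (fromRef_mem hab hx)).hasDerivWithinAt
    refine (((hasDerivWithinAt_comp_fromRef hab hd).const_smul (((b - a) / 2) ^ i)).derivWithin
      (uniqueDiffOn_refIcc x hx)).trans ?_
    rw [smul_smul, pow_succ]

theorem ScaledBound.comp_fromRef {a b : ℝ} (hab : a < b) {g : ℝ → E} {n : ℕ}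
    (hg : ContDiffOn ℝ n g (Set.Icc a b)) {K : ℝ}
    (hK : ∀ l ≤ n, ∀ s ∈ Set.Icc a b, ‖iteratedDerivWithin l g (Set.Icc a b) s‖ ≤ K) :
    ScaledBound n (b - a) K (fun x => g (fromRef a b x)) := by
  have hT : ContDiff ℝ n (fromRef a b) := by unfold fromRef; fun_prop
  have h0 : 0 ≤ b - a := by linarith
  refine ⟨hg.comp hT.contDiffOn fun x hx => fromRef_mem hab hx, fun l hl x hx => ?_⟩
  rw [iteratedDerivWithin_comp_fromRef hab hg hl hx, norm_smul, mul_comm, Real.norm_eq_abs,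
    abs_of_nonneg (by positivity)]
  have hK0 := hK l hl _ (fromRef_mem hab hx)
  have : 0 ≤ K := (norm_nonneg _).trans hK0
  gcongr
  linarith

theorem ScaledBound.fromRef {a b c : ℝ} (hab : a < b) (n : ℕ) (hc : ∀ s ∈ Set.Icc a b, |s| ≤ c) :
    ScaledBound n (b - a) (c + 1) (fromRef a b) := by
  have hc0 : 0 ≤ c := (abs_nonneg _).trans (hc a ⟨le_rfl, hab.le⟩)
  refine ScaledBound.comp_fromRef hab (g := fun s => s) contDiffOn_id fun l _ s hs => ?_
  have := iteratedDerivWithin_id (n := l) hs (uniqueDiffOn_Icc hab)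
  change iteratedDerivWithin l (fun s => s) _ s = _ at this
  rw [this]
  split_ifs
  · exact (hc s hs).trans (by linarith)
  · simpa using hc0
  · simp only [norm_zero]; linarith

end Transform

/-! ### Uniform bounds on compact sets -/

theorem exists_iteratedFDerivWithin_bound {V W : Type*} [NormedAddCommGroup V] [NormedSpace ℝ V]
    [NormedAddCommGroup W] [NormedSpace ℝ W] {n : ℕ} {Φ : V → W} {s s' : Set V}
    (hΦ : ContDiffOn ℝ n Φ s) (hs : UniqueDiffOn ℝ s) (hs' : IsCompact s') (hss : s' ⊆ s) :
    ∃ D : ℝ, 0 ≤ D ∧ ∀ i ≤ n, ∀ y ∈ s', ‖iteratedFDerivWithin ℝ i Φ s y‖ ≤ D := by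
  have : ∀ i : ℕ, ∃ D : ℝ, 0 ≤ D ∧ (i ≤ n → ∀ y ∈ s', ‖iteratedFDerivWithin ℝ i Φ s y‖ ≤ D) := by
    intro i
    by_cases hi : i ≤ n
    · obtain ⟨D, hD⟩ := hs'.exists_bound_of_continuousOn
        ((hΦ.continuousOn_iteratedFDerivWithin (m := i) (by exact_mod_cast hi) hs).mono hss)
      exact ⟨max D 0, le_max_right _ _, fun _ y hy => (hD y hy).trans (le_max_left _ _)⟩
    · exact ⟨0, le_rfl, fun h => absurd h hi⟩
  choose D hD0 hD using this
  refine ⟨∑ i ∈ Finset.range (n + 1), D i, Finset.sum_nonneg fun i _ => hD0 i,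
    fun i hi y hy => (hD i hi y hy).trans ?_⟩
  exact Finset.single_le_sum (f := D) (fun i _ => hD0 i) (Finset.mem_range.2 (by omega))

section PartialDerivative

variable {E : Type*} [NormedAddCommGroup E] [NormedSpace ℝ E] {W : Type*} [NormedAddCommGroup W]
  [NormedSpace ℝ W]

/-- The derivative of `Φ` with respect to the second variable, on the strip `I × E`. -/
noncomputable def sndDeriv (I : Set ℝ) (Φ : ℝ × E → W) (y : ℝ × E) : E →L[ℝ] W :=
  (fderivWithin ℝ Φ (I ×ˢ Set.univ) y).comp (ContinuousLinearMap.inr ℝ ℝ E)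

theorem hasFDerivAt_sndDeriv {I : Set ℝ} {Φ : ℝ × E → W}
    (hΦ : DifferentiableOn ℝ Φ (I ×ˢ Set.univ)) {t : ℝ} (ht : t ∈ I) (x : E) :
    HasFDerivAt (fun x => Φ (t, x)) (sndDeriv I Φ (t, x)) x := by
  have h1 := (hΦ (t, x) ⟨ht, trivial⟩).hasFDerivWithinAt
  have h2 := h1.comp (s := Set.univ) x (hasFDerivAt_prodMk_right t x).hasFDerivWithinAt
    fun y _ => ⟨ht, trivial⟩
  exact hasFDerivWithinAt_univ.1 h2

theorem contDiffOn_sndDeriv {I : Set ℝ} (hI : UniqueDiffOn ℝ I) {Φ : ℝ × E → W} {n : ℕ}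
    (hΦ : ContDiffOn ℝ (n + 1 : ℕ) Φ (I ×ˢ Set.univ)) :
    ContDiffOn ℝ n (sndDeriv I Φ) (I ×ˢ Set.univ) :=
  (hΦ.fderivWithin (hI.prod uniqueDiffOn_univ) (by norm_cast)).clm_comp contDiffOn_const

theorem norm_sndDeriv_le {I : Set ℝ} (hI : UniqueDiffOn ℝ I) {Φ : ℝ × E → W} {y : ℝ × E} {D : ℝ}
    (hy : y ∈ I ×ˢ (Set.univ : Set E))
    (hD : ‖iteratedFDerivWithin ℝ 1 Φ (I ×ˢ Set.univ) y‖ ≤ D) : ‖sndDeriv I Φ y‖ ≤ D := by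
  rw [norm_iteratedFDerivWithin_one _ (hI.prod uniqueDiffOn_univ _ hy)] at hD
  refine (ContinuousLinearMap.opNorm_comp_le _ _).trans ?_
  refine (mul_le_of_le_one_right (norm_nonneg _) ?_).trans hD
  exact ContinuousLinearMap.norm_inr_le_one ℝ ℝ E

/-- Second order Taylor estimate in the second variable. -/
theorem norm_sub_sub_sndDeriv_le {I : Set ℝ} (hI : UniqueDiffOn ℝ I) {Φ : ℝ × E → W} {D ρ : ℝ}
    (hΦ : ContDiffOn ℝ (2 : ℕ) Φ (I ×ˢ Set.univ))
    (hD : ∀ y ∈ I ×ˢ Metric.closedBall (0 : E) ρ,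
      ‖iteratedFDerivWithin ℝ 1 (sndDeriv I Φ) (I ×ˢ Set.univ) y‖ ≤ D)
    {t : ℝ} (ht : t ∈ I) {x y : E} (hx : x ∈ Metric.closedBall (0 : E) ρ)
    (hy : y ∈ Metric.closedBall (0 : E) ρ) :
    ‖Φ (t, y) - Φ (t, x) - sndDeriv I Φ (t, x) (y - x)‖ ≤ D * ‖y - x‖ ^ 2 := by
  have hseg : segment ℝ x y ⊆ Metric.closedBall (0 : E) ρ :=
    (convex_closedBall (0 : E) ρ).segment_subset hx hy
  have hdiff := hΦ.differentiableOn (by norm_num)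
  have hdiff' := (contDiffOn_sndDeriv hI (n := 1) hΦ).differentiableOn (by norm_num)
  have hlip : ∀ z ∈ segment ℝ x y,
      ‖sndDeriv I Φ (t, z) - sndDeriv I Φ (t, x)‖ ≤ D * ‖y - x‖ := by
    intro z hz
    have h1 := (convex_segment x y).norm_image_sub_le_of_norm_hasFDerivWithin_le
      (f := fun z => sndDeriv I Φ (t, z)) (f' := fun z => sndDeriv I (sndDeriv I Φ) (t, z))
      (C := D) (fun z _ => (hasFDerivAt_sndDeriv hdiff' ht z).hasFDerivWithinAt)
      (fun z hz => norm_sndDeriv_le hI ⟨ht, trivial⟩ (hD _ ⟨ht, hseg hz⟩))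
      (left_mem_segment ℝ x y) hz
    refine h1.trans ?_
    have hD0 : 0 ≤ D := (norm_nonneg _).trans (hD (t, x) ⟨ht, hx⟩)
    exact mul_le_mul_of_nonneg_left (norm_sub_le_of_mem_segment hz) hD0
  have := (convex_segment x y).norm_image_sub_le_of_norm_hasFDerivWithin_le'
    (f := fun z => Φ (t, z)) (f' := fun z => sndDeriv I Φ (t, z))
    (φ := sndDeriv I Φ (t, x)) (C := D * ‖y - x‖)
    (fun z _ => (hasFDerivAt_sndDeriv hdiff ht z).hasFDerivWithinAt) hlip
    (left_mem_segment ℝ x y) (right_mem_segment ℝ x y)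
  refine this.trans (le_of_eq ?_)
  ring

end PartialDerivative

/-! ### The approximate dual solution -/

/-- Picard iteration for the dual problem `Z' = -h Z B`, `Z(1) = 1`. Each iterate `Z` comes with
its predecessor `Y`, from which it is at distance `O(h^n)`. -/
theorem exists_picard_iterate {𝔸 : Type*} [NormedRing 𝔸] [NormedAlgebra ℝ 𝔸] [CompleteSpace 𝔸]
    (M : ℕ) (C : ℝ) (n : ℕ) : ∃ K : ℝ, 0 ≤ K ∧ ∀ (h : ℝ) (B : ℝ → 𝔸), 0 ≤ h → h ≤ 1 →
      ScaledBound M h C B → ∃ Z Y : ℝ → 𝔸, ScaledBound M h K Z ∧ ScaledBound M h K Y ∧ Z 1 = 1 ∧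
        (∀ x ∈ RefIcc, HasDerivWithinAt Z (h • -(Y x * B x)) RefIcc x) ∧
        ∀ x ∈ RefIcc, ‖Z x - Y x‖ ≤ K * h ^ n := by
  induction n with
  | zero =>
    refine ⟨‖(1 : 𝔸)‖, norm_nonneg _, fun h B h0 _ _ => ⟨fun _ => 1, fun _ => 0,
      ScaledBound.const _ h0, (ScaledBound.zero h0).mono h0 (norm_nonneg _), rfl, fun x _ => ?_,
      fun x _ => by simp⟩⟩
    simpa using hasDerivWithinAt_const x RefIcc (1 : 𝔸)
  | succ n ih =>
    obtain ⟨K, hK, ih⟩ := ih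
    rcases lt_or_ge C 0 with hC | hC
    · exact ⟨0, le_rfl, fun h B _ _ hB => absurd hB.nonneg (not_le.2 hC)⟩
    set L := ‖ContinuousLinearMap.mul ℝ 𝔸‖ * (2 ^ M * K * C) with hL
    have hL0 : 0 ≤ L := by positivity
    refine ⟨K + (‖(1 : 𝔸)‖ + 2 * L) + 2 * (K * C), by positivity, fun h B h0 h1 hB => ?_⟩
    obtain ⟨Z, Y, hZ, hY, hZ1, hZd, hZY⟩ := ih h B h0 h1 hB
    have hm1 : (-1 : ℝ) ≤ 1 := by norm_num
    -- `Z B` is extended continuously beyond `[-1, 1]`, so that its integral is differentiable there.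
    set w : ℝ → 𝔸 := Set.IccExtend hm1 (RefIcc.domRestrict fun x => Z x * B x) with hw
    have hwc : Continuous w := by
      refine Continuous.Icc_extend' ?_
      exact (hZ.continuousOn.mul hB.continuousOn).domRestrict
    have hwe : ∀ x ∈ RefIcc, w x = Z x * B x := fun x hx => by
      rw [hw, Set.IccExtend_of_mem _ _ hx]; rfl
    set Z₁ : ℝ → 𝔸 := fun x => 1 + h • ∫ s in x..1, w s with hZ₁
    have hZ₁d : ∀ x ∈ RefIcc, HasDerivWithinAt Z₁ (h • -(Z x * B x)) RefIcc x := by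
      intro x hx
      rw [← hwe x hx]
      have := intervalIntegral.integral_hasDerivAt_left (hwc.intervalIntegrable x 1)
        (hwc.stronglyMeasurableAtFilter _ _) hwc.continuousAt
      exact ((this.const_smul h).const_add 1).hasDerivWithinAt
    have hZB : ScaledBound M h L (fun x => Z x * B x) := by
      simpa using ScaledBound.bilin (ContinuousLinearMap.mul ℝ 𝔸) h0 hZ hB
    have hZ₁n : ∀ x ∈ RefIcc, ‖Z₁ x‖ ≤ ‖(1 : 𝔸)‖ + 2 * L := by
      intro x hx
      have hi := intervalIntegral.norm_integral_le_of_norm_le_const (a := x) (b := 1) (f := w)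
        (C := L) (fun s hs => by
          rw [Set.uIoc_of_le hx.2] at hs
          have hs' : s ∈ RefIcc := ⟨hx.1.trans hs.1.le, hs.2⟩
          rw [hwe s hs']
          exact hZB.norm_le hs')
      have h2 : |1 - x| ≤ 2 := by rw [abs_le]; constructor <;> linarith [hx.1, hx.2]
      refine (norm_add_le _ _).trans ?_
      gcongr
      rw [norm_smul, Real.norm_eq_abs, abs_of_nonneg h0]
      calc _ ≤ 1 * (L * |1 - x|) := by gcongr
        _ ≤ 1 * (L * 2) := by gcongr
        _ = _ := by ring
    have hZ₁b : ScaledBound M h (‖(1 : 𝔸)‖ + 2 * L) Z₁ := by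
      refine (ScaledBound.of_hasDeriv h0 (hZB.neg.mono h0 ?_) hZ₁d hZ₁n).of_le (Nat.le_succ M)
      have := norm_nonneg (1 : 𝔸)
      linarith
    refine ⟨Z₁, Z, hZ₁b.mono h0 ?_, hZ.mono h0 ?_, by simp [hZ₁], hZ₁d, fun x hx => ?_⟩
    · have : 0 ≤ K * C := by positivity
      linarith
    · have : 0 ≤ K * C := by positivity
      have := norm_nonneg (1 : 𝔸)
      linarith
    · have hdiff := (convex_Icc (-1 : ℝ) 1).norm_image_sub_le_of_norm_hasDerivWithin_le
        (f := fun x => Z₁ x - Z x) (f' := fun x => h • -(Z x * B x) - h • -(Y x * B x))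
        (C := h * (K * h ^ n * C)) (fun y hy => (hZ₁d y hy).sub (hZd y hy))
        (fun y hy => by
          have e : h • -(Z y * B y) - h • -(Y y * B y) = -(h • ((Z y - Y y) * B y)) := by
            rw [← smul_sub, sub_mul, ← smul_neg]
            congr 1
            abel
          rw [e, norm_neg, norm_smul, Real.norm_eq_abs, abs_of_nonneg h0]
          gcongr
          refine (norm_mul_le _ _).trans ?_
          have := hZY y hy
          have := hB.norm_le hy
          gcongr)
        (show (1 : ℝ) ∈ Set.Icc (-1 : ℝ) 1 by simp) hx
      have e1 : Z₁ 1 - Z 1 = 0 := by simp [hZ₁, hZ1]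
      rw [e1, sub_zero] at hdiff
      have h2 : ‖x - 1‖ ≤ 2 := by
        rw [Real.norm_eq_abs, abs_le]; constructor <;> linarith [hx.1, hx.2]
      refine hdiff.trans ?_
      calc _ ≤ h * (K * h ^ n * C) * 2 := by gcongr
        _ = 2 * (K * C) * h ^ (n + 1) := by ring
        _ ≤ _ := by
          gcongr
          have := norm_nonneg (1 : 𝔸)
          linarith

/-! ### From the local problem to the reference interval -/

theorem comp_linear_mem_degreeLT {p : ℝ[X]} {n : ℕ} (hp : p ∈ degreeLT ℝ n) (a b : ℝ) :
    p.comp (Polynomial.C a + Polynomial.C b * X) ∈ degreeLT ℝ n := by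
  rcases eq_or_ne p 0 with rfl | h0
  · simp
  · have h1 := (natDegree_lt_iff_degree_lt h0).2 (mem_degreeLT.1 hp)
    have h2 : (Polynomial.C a + Polynomial.C b * X : ℝ[X]).natDegree ≤ 1 := by
      rw [add_comm]; exact natDegree_linear_le
    have h3 : (p.comp (Polynomial.C a + Polynomial.C b * X)).natDegree < n := by
      refine (natDegree_comp_le.trans ?_).trans_lt h1
      exact mul_le_of_le_one_right (Nat.zero_le _) h2
    rw [mem_degreeLT]
    exact degree_le_natDegree.trans_lt (by exact_mod_cast h3)

theorem derivative_mem_degreeLT {p : ℝ[X]} {n : ℕ} (hp : p ∈ degreeLT ℝ (n + 1)) :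
    derivative p ∈ degreeLT ℝ n := by
  rw [mem_degreeLT, degree_lt_iff_coeff_zero] at hp ⊢
  intro m hm
  rw [coeff_derivative, hp (m + 1) (by omega), zero_mul]

section VecPoly

variable {d s : ℕ} {φ : ℝ → Vec d}

theorem IsVecPoly.contDiff (hφ : IsVecPoly s φ) (n : WithTop ℕ∞) : ContDiff ℝ n φ := by
  obtain ⟨c, hc⟩ := hφ
  rw [show φ = _ from funext hc]
  fun_prop

theorem IsVecPoly.exists_polynomial (hφ : IsVecPoly s φ) (j : Fin d) :
    ∃ w ∈ degreeLT ℝ (s + 1), ∀ t, φ t j = w.eval t := by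
  obtain ⟨c, hc⟩ := hφ
  refine ⟨∑ i ∈ Finset.range (s + 1), Polynomial.C (c i j) * X ^ i,
    Submodule.sum_mem _ fun i hi => ?_, fun t => ?_⟩
  · rw [← smul_eq_C_mul]
    refine Submodule.smul_mem _ _ ?_
    rw [mem_degreeLT, degree_X_pow]
    exact_mod_cast Finset.mem_range.1 hi
  · rw [hc, eval_finsetSum, WithLp.ofLp_sum, Finset.sum_apply]
    refine Finset.sum_congr rfl fun i _ => ?_
    rw [eval_mul, eval_C, eval_pow, eval_X, PiLp.smul_apply, smul_eq_mul, mul_comm]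

theorem isVecPoly_smul {g : ℝ[X]} (hg : g ∈ degreeLT ℝ (s + 1)) (e : Vec d) :
    IsVecPoly s (fun t => g.eval t • e) := by
  refine ⟨fun i => g.coeff i • e, fun t => ?_⟩
  have : g.natDegree < s + 1 := by
    rcases eq_or_ne g 0 with rfl | h0
    · simp
    · exact (natDegree_lt_iff_degree_lt h0).2 (mem_degreeLT.1 hg)
  simp only [eval_eq_sum_range' this, Finset.sum_smul]
  refine Finset.sum_congr rfl fun i _ => ?_
  rw [smul_smul, mul_comm]

theorem deriv_apply_of_contDiff (hφ : ContDiff ℝ 1 φ) (t : ℝ) (j : Fin d) :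
    HasDerivAt (fun t => φ t j) (deriv φ t j) t := by
  have h := (hφ.differentiable (by norm_num) t).hasDerivAt
  exact ((EuclideanSpace.proj j : Vec d →L[ℝ] ℝ).hasFDerivAt.comp_hasDerivAt t h)

end VecPoly

/-- Each component of a local solution satisfies the problem on the reference interval. -/
theorem IsLocalSolution.exists_refProblem {d q p r k : ℕ} {Q : RefIntegrator q} {A : RefApprox p}
    {f : ℝ → Vec d → Vec d} {a b : ℝ} {U₀ : Vec d} {P : ℝ → Vec d}
    (hP : IsLocalSolution r k Q A f a b U₀ P) (hab : a < b) (hkr : k ≤ r) {M : ℕ}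
    (hf : ContDiffOn ℝ M (fun t => f t (P t)) (Set.Icc a b)) (hpq : max p q ≤ M) (hrM : r ≤ M)
    (j : Fin d) :
    ∃ W : ℝ[X], (∀ x, W.eval x = deriv P (fromRef a b x) j) ∧
      RefProblem r k Q A (fun x => f (fromRef a b x) (P (fromRef a b x)) j) W
        (2 / (b - a) * (P a - U₀) j) := by
  have hba : b - a ≠ 0 := by linarith
  have hqM : q ≤ M := (le_max_right _ _).trans hpq
  have hPc := hP.poly.contDiff
  obtain ⟨w, hw, hwe⟩ := hP.poly.exists_polynomial j
  have hwd : ∀ t, (derivative w).eval t = deriv P t j := fun t => by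
    have h1 := deriv_apply_of_contDiff (hPc 1) t j
    rw [show (fun t => P t j) = fun t => w.eval t from funext hwe] at h1
    exact (w.hasDerivAt t).unique h1
  set W : ℝ[X] := (derivative w).comp (Polynomial.C ((a + b) / 2) + Polynomial.C ((b - a) / 2) * X)
    with hW
  have hWe : ∀ x, W.eval x = deriv P (fromRef a b x) j := fun x => by
    rw [hW, eval_comp, ← hwd]
    simp [fromRef]
  set g : ℝ → Vec d := fun t => f t (P t) - deriv P t with hg
  have hPd : ContDiff ℝ M (deriv P) :=
    ((contDiff_succ_iff_deriv (n := (M : WithTop ℕ∞))).1 (hPc _)).2.2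
  have hgc : ContDiffOn ℝ M g (Set.Icc a b) := hf.sub hPd.contDiffOn
  have hFc : ContDiffOn ℝ M (fun x => f (fromRef a b x) (P (fromRef a b x)) j) RefIcc := by
    have hT : ContDiff ℝ M (fromRef a b) := by unfold fromRef; fun_prop
    have h1 := hf.comp hT.contDiffOn fun x hx => fromRef_mem hab hx
    exact (EuclideanSpace.proj j : Vec d →L[ℝ] ℝ).contDiff.comp_contDiffOn h1
  have hzero : ∀ i ≤ M, ∀ x ∈ RefIcc,
      iteratedDeriv (i + 1) P (fromRef a b x) =
        iteratedDerivWithin i (fun t => f t (P t)) (Set.Icc a b) (fromRef a b x) →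
      iteratedDerivWithin i
        (fun x => f (fromRef a b x) (P (fromRef a b x)) j - W.eval x) RefIcc x = 0 := by
    intro i hi x hx h'
    have hud := uniqueDiffOn_Icc hab
    have hmem := fromRef_mem hab hx
    have hi' : (i : WithTop ℕ∞) ≤ M := by exact_mod_cast hi
    have h1 : iteratedDerivWithin i g (Set.Icc a b) (fromRef a b x) = 0 := by
      have hs := iteratedDerivWithin_sub (n := i) hmem hud ((hf _ hmem).of_le hi')
        ((hPd.of_le hi').contDiffAt.contDiffWithinAt)
      refine hs.trans ?_
      rw [← h', iteratedDerivWithin_eq_iteratedDeriv hud (hPd.of_le hi').contDiffAt hmem,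
        iteratedDeriv_succ', sub_self]
    have h2 := iteratedDerivWithin_comp_fromRef hab hgc hi hx
    rw [h1, smul_zero] at h2
    have hgT : ContDiffOn ℝ M (fun x => g (fromRef a b x)) RefIcc := by
      have hT : ContDiff ℝ M (fromRef a b) := by unfold fromRef; fun_prop
      exact hgc.comp hT.contDiffOn fun x hx => fromRef_mem hab hx
    have h3 := (EuclideanSpace.proj j : Vec d →L[ℝ] ℝ).norm_iteratedFDerivWithin_comp_left
      (hgT x hx) uniqueDiffOn_refIcc hx (n := i) hi'
    rw [norm_iteratedFDerivWithin_eq_norm_iteratedDerivWithin,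
      norm_iteratedFDerivWithin_eq_norm_iteratedDerivWithin, h2, norm_zero, mul_zero] at h3
    rw [← norm_le_zero_iff]
    refine le_trans (le_of_eq ?_) h3
    congr 2
    ext y
    simp [hg, hWe]
  refine ⟨W, hWe, comp_linear_mem_degreeLT (derivative_mem_degreeLT hw) _ _, fun i hi => ?_,
    fun i hi => ?_, fun φ hφ => ?_⟩
  · refine hzero i (by omega) 1 (by simp) ?_
    rw [fromRef_one]
    exact hP.right i hi
  · refine hzero i (by omega) (-1) (by simp) ?_
    rw [fromRef_neg_one]
    exact hP.left i hi
  · -- The test function is `φ ∘ T⁻¹` in the component `j`.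
    set G : ℝ[X] := φ.comp (Polynomial.C (-(a + b) / (b - a)) + Polynomial.C (2 / (b - a)) * X)
      with hG
    have hGe : ∀ t, G.eval t = φ.eval (toRef a b t) := fun t => by
      rw [hG, eval_comp]
      congr 1
      simp only [eval_add, eval_C, eval_mul, eval_X, toRef]
      ring
    have hv := hP.variational _ (isVecPoly_smul (comp_linear_mem_degreeLT hφ (-(a + b) / (b - a)) (2 / (b - a)))
      (EuclideanSpace.single j (1 : ℝ)))
    rw [← hG] at hv
    simp only [hGe, RefIntegrator.onInterval, RefApprox.onInterval, toRef_fromRef hab,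
      toRef_left hab, inner_smul_right, EuclideanSpace.inner_single_right, RefApprox.vec] at hv
    have hF : ContDiffOn ℝ q (fun x => f (fromRef a b x) (P (fromRef a b x)) j) RefIcc :=
      hFc.of_le (by exact_mod_cast hqM)
    have hAF : ContDiffOn ℝ q
        (A.toFun fun x => f (fromRef a b x) (P (fromRef a b x)) j) RefIcc :=
      A.smooth q _ (hFc.of_le (by exact_mod_cast hpq))
    have hφc : ContDiffOn ℝ q (fun x => φ.eval x) RefIcc :=
      (contDiff_polynomial_eval _ _).contDiffOn
    have hWc : ContDiffOn ℝ q (fun x => W.eval x) RefIcc :=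
      (contDiff_polynomial_eval _ _).contDiffOn
    have e1 := Q.map_sub (hF.mul hφc) (hWc.mul hφc)
    have e2 := Q.map_sub (hF.mul hφc) (hAF.mul hφc)
    simp only [← sub_mul] at e1 e2
    rw [e1, e2]
    have e3 : Q.toFun (fun x => W.eval x * φ.eval x) +
        (if k = 0 then 2 / (b - a) * (P a - U₀) j * φ.eval (-1) else 0) =
        Q.toFun (fun x => A.toFun (fun y => f (fromRef a b y) (P (fromRef a b y)) j) x *
          φ.eval x) := by
      have hh : (b - a) / 2 ≠ 0 := by positivity
      refine mul_left_cancel₀ hh ?_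
      rw [mul_add]
      have c1 : (fun x => W.eval x * φ.eval x) =
          fun x => φ.eval x * (deriv P (fromRef a b x) j) := by
        ext x; rw [hWe, mul_comm]
      have c2 : (fun x => A.toFun (fun y => f (fromRef a b y) (P (fromRef a b y)) j) x *
          φ.eval x) = fun x => φ.eval x *
            A.toFun (fun y => f (fromRef a b y) (P (fromRef a b y)) j) x := by
        ext x; rw [mul_comm]
      rw [c1, c2]
      simp only [one_mul, conj_trivial] at hv
      rw [← hv]
      congr 1
      split_ifs
      · field_simp
      · simp
    linarith

/-! ### The error on one interval -/

/-- The entries of the matrix of an operator on `ℝ^d`. -/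
noncomputable def entry {d : ℕ} (i j : Fin d) : (Vec d →L[ℝ] Vec d) →L[ℝ] ℝ :=
  (EuclideanSpace.proj i : Vec d →L[ℝ] ℝ).comp
    (ContinuousLinearMap.apply ℝ (Vec d) (EuclideanSpace.single j (1 : ℝ)))

theorem norm_entry_le {d : ℕ} (i j : Fin d) : ‖entry i j‖ ≤ 1 := by
  refine ContinuousLinearMap.opNorm_le_bound _ zero_le_one fun L => ?_
  rw [one_mul]
  have h1 : ‖L (EuclideanSpace.single j (1 : ℝ)) i‖ ≤ ‖L (EuclideanSpace.single j (1 : ℝ))‖ :=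
    PiLp.norm_apply_le _ i
  refine h1.trans ((L.le_opNorm _).trans ?_)
  simp

theorem apply_eq_sum_entry {d : ℕ} (L : Vec d →L[ℝ] Vec d) (w : Vec d) (i : Fin d) :
    L w i = ∑ j, w j * entry i j L := by
  have hw : w = ∑ j, w j • (EuclideanSpace.single j (1 : ℝ) : Vec d) := by
    have := (EuclideanSpace.basisFun (Fin d) ℝ).sum_repr w
    simpa using this.symm
  conv_lhs => rw [hw]
  simp [entry]

theorem norm_le_sum_abs {d : ℕ} (v : Vec d) : ‖v‖ ≤ ∑ i, |v i| := by
  have hv : v = ∑ j, v j • (EuclideanSpace.single j (1 : ℝ) : Vec d) := by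
    have := (EuclideanSpace.basisFun (Fin d) ℝ).sum_repr v
    simpa using this.symm
  conv_lhs => rw [hv]
  refine (norm_sum_le _ _).trans (le_of_eq ?_)
  simp [norm_smul]

/-- Componentwise bounds for the defect functional bound the vector valued one. -/
theorem norm_integral_apply_sub_le {d : ℕ} {Z : ℝ → Vec d →L[ℝ] Vec d} {R : ℝ → Vec d} {J : Vec d}
    {c : ℝ} (hZ : ContinuousOn Z RefIcc) (hR : ContinuousOn R RefIcc)
    (hc : ∀ i j : Fin d, |(∫ x in (-1 : ℝ)..1, R x j * entry i j (Z x)) -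
      J j * entry i j (Z (-1))| ≤ c) :
    ‖(∫ x in (-1 : ℝ)..1, Z x (R x)) - Z (-1) J‖ ≤ d * (d * c) := by
  have huI : Set.uIcc (-1 : ℝ) 1 = RefIcc := Set.uIcc_of_le (by norm_num)
  refine (norm_le_sum_abs _).trans ?_
  have hi : ∀ i ∈ (Finset.univ : Finset (Fin d)),
      |((∫ x in (-1 : ℝ)..1, Z x (R x)) - Z (-1) J) i| ≤ d * c := by
    intro i _
    have h1 : (∫ x in (-1 : ℝ)..1, Z x (R x)) i = ∫ x in (-1 : ℝ)..1, (Z x (R x)) i := by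
      have := (EuclideanSpace.proj i : Vec d →L[ℝ] ℝ).intervalIntegral_comp_comm
        (μ := MeasureTheory.volume) (a := -1) (b := 1) (f := fun x => Z x (R x))
        (ContinuousOn.intervalIntegrable (by rw [huI]; exact hZ.clm_apply hR))
      exact this.symm
    have h2 : ∫ x in (-1 : ℝ)..1, (Z x (R x)) i =
        ∑ j, ∫ x in (-1 : ℝ)..1, R x j * entry i j (Z x) := by
      simp only [apply_eq_sum_entry]
      refine intervalIntegral.integral_finsetSum fun j _ => ContinuousOn.intervalIntegrable ?_
      rw [huI]
      exact ((EuclideanSpace.proj j : Vec d →L[ℝ] ℝ).continuous.comp_continuousOn hR).mul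
        ((entry i j).continuous.comp_continuousOn hZ)
    rw [PiLp.sub_apply, h1, h2, apply_eq_sum_entry, ← Finset.sum_sub_distrib]
    refine (Finset.abs_sum_le_sum_abs _ _).trans
      ((Finset.sum_le_card_nsmul _ _ _ fun j _ => hc i j).trans (le_of_eq ?_))
    simp
  refine (Finset.sum_le_card_nsmul _ _ _ hi).trans (le_of_eq ?_)
  simp

/-- The error representation: if `Z` nearly solves the dual problem `Z' = -h Z B` and `e` nearly
solves `e' = (h/2) R + h B e`, then the increment of `Z e` is nearly `(h/2) ∫ Z R`. -/
theorem norm_apply_sub_apply_sub_integral_le {E : Type*} [NormedAddCommGroup E] [NormedSpace ℝ E]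
    [CompleteSpace E] {h K ε η δ : ℝ} (h0 : 0 ≤ h) (hK : 0 ≤ K) (hε : 0 ≤ ε)
    {Z Zd B : ℝ → E →L[ℝ] E} {e e' R : ℝ → E}
    (hZ : ∀ x ∈ RefIcc, HasDerivWithinAt Z (h • Zd x) RefIcc x)
    (he : ∀ x ∈ RefIcc, HasDerivWithinAt e (e' x) RefIcc x)
    (hZdc : ContinuousOn Zd RefIcc) (hec : ContinuousOn e' RefIcc) (hRc : ContinuousOn R RefIcc)
    (hZK : ∀ x ∈ RefIcc, ‖Z x‖ ≤ K) (hZB : ∀ x ∈ RefIcc, ‖Zd x + Z x * B x‖ ≤ ε)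
    (heη : ∀ x ∈ Set.Ioc (-1 : ℝ) 1, ‖e x‖ ≤ η)
    (heδ : ∀ x ∈ Set.Ioc (-1 : ℝ) 1, ‖e' x - (h / 2) • R x - h • B x (e x)‖ ≤ h * δ) :
    ‖Z 1 (e 1) - Z (-1) (e (-1)) - (h / 2) • ∫ x in (-1 : ℝ)..1, Z x (R x)‖ ≤
      2 * (h * (ε * η + K * δ)) := by
  have hm1 : (-1 : ℝ) ≤ 1 := by norm_num
  have huI : Set.uIcc (-1 : ℝ) 1 = RefIcc := Set.uIcc_of_le hm1
  have hZc : ContinuousOn Z RefIcc := fun x hx => (hZ x hx).continuousWithinAt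
  have hecc : ContinuousOn e RefIcc := fun x hx => (he x hx).continuousWithinAt
  set g : ℝ → E := fun x => (h • Zd x) (e x) + Z x (e' x) with hg
  have hgc : ContinuousOn g RefIcc := ((hZdc.const_smul h).clm_apply hecc).add (hZc.clm_apply hec)
  have hgi : IntervalIntegrable g MeasureTheory.volume (-1) 1 :=
    ContinuousOn.intervalIntegrable (by rw [huI]; exact hgc)
  have hftc : ∫ x in (-1 : ℝ)..1, g x = Z 1 (e 1) - Z (-1) (e (-1)) := by
    refine intervalIntegral.integral_eq_sub_of_hasDerivAt_of_le (f := fun x => Z x (e x)) hm1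
      (hZc.clm_apply hecc) (fun x hx => ?_) hgi
    have hn : RefIcc ∈ nhds x := Icc_mem_nhds hx.1 hx.2
    have hx' := Set.Ioo_subset_Icc_self hx
    exact ((hZ x hx').hasDerivAt hn).clm_apply ((he x hx').hasDerivAt hn)
  have hRi : IntervalIntegrable (fun x => (h / 2) • Z x (R x)) MeasureTheory.volume (-1) 1 :=
    ContinuousOn.intervalIntegrable (by
      rw [huI]; exact (hZc.clm_apply hRc).const_smul (h / 2))
  rw [← hftc, ← intervalIntegral.integral_smul, ← intervalIntegral.integral_sub hgi hRi]
  refine (intervalIntegral.norm_integral_le_of_norm_le_const (C := h * (ε * η + K * δ))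
    fun x hx => ?_).trans (le_of_eq ?_)
  · rw [Set.uIoc_of_le hm1] at hx
    have hx' := Set.Ioc_subset_Icc_self hx
    have hdec : g x - (h / 2) • Z x (R x) = h • (Zd x + Z x * B x) (e x) +
        Z x (e' x - (h / 2) • R x - h • B x (e x)) := by
      simp only [hg, map_sub, map_smul, add_apply, smul_add,
        mul_apply_eq_comp, smul_apply]
      abel
    rw [hdec]
    refine (norm_add_le _ _).trans ?_
    have b1 : ‖h • (Zd x + Z x * B x) (e x)‖ ≤ h * (ε * η) := by
      rw [norm_smul, Real.norm_eq_abs, abs_of_nonneg h0]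
      refine mul_le_mul_of_nonneg_left ?_ h0
      refine (ContinuousLinearMap.le_opNorm _ _).trans ?_
      exact mul_le_mul (hZB x hx') (heη x hx) (norm_nonneg _) hε
    have b2 : ‖Z x (e' x - (h / 2) • R x - h • B x (e x))‖ ≤ K * (h * δ) := by
      refine (ContinuousLinearMap.le_opNorm _ _).trans ?_
      exact mul_le_mul (hZK x hx') (heδ x hx) (norm_nonneg _) hK
    linarith
  · norm_num
    ring

/-- The arithmetic that combines the contributions of the initial error, the defect functional and
the remainder of the error representation. -/
theorem combine_bounds {X X₁ X₂ X₃ h n e s : ℝ} (hX : 0 ≤ X) (hX₁ : 0 ≤ X₁) (hX₂ : 0 ≤ X₂)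
    (hX₃ : 0 ≤ X₃) (hh : 0 ≤ h) (hn : 0 ≤ n) (he : 0 ≤ e) (hs : 0 ≤ s) :
    (1 + X * h) * n + h / 2 * (X₁ * s) + (X₂ * h * s + X₃ * h * e) ≤
      (1 + (X + X₁ + X₂ + X₃) * h) * n + (X + X₁ + X₂ + X₃) * h * (e + s) := by
  rw [← sub_nonneg]
  have : (1 + (X + X₁ + X₂ + X₃) * h) * n + (X + X₁ + X₂ + X₃) * h * (e + s) -
      ((1 + X * h) * n + h / 2 * (X₁ * s) + (X₂ * h * s + X₃ * h * e)) =
      (X₁ + X₂ + X₃) * h * n + (X + X₁ + X₂) * h * e + (X + X₁ / 2 + X₃) * h * s := by ring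
  rw [this]
  positivity

set_option maxHeartbeats 1000000 in
/-- One step of the method increases the error at the mesh points by a factor `1 + O(h)` and adds
`O(h (E^2 + h^σ))`, where `E` bounds the error on the interval. -/
theorem exists_local_error_bound {d q p r k : ℕ} (hkr : k ≤ r)
    {Q : RefIntegrator q} {A : RefApprox p} (hQu : Q.Unisolvent r k) {CQ CA : ℝ} (hCQ : 0 ≤ CQ)
    (hCA : 0 ≤ CA) (hQ : ∀ c v, ScaledBound q 1 c v → |Q.toFun v| ≤ CQ * c)
    (hA : ∀ c v, ScaledBound (max p q) 1 c v → ScaledBound q 1 (CA * c) (A.toFun v))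
    {M σ : ℕ} (hpq : max p q ≤ M) (hrM : r + 1 ≤ M) (hσM : σ ≤ M)
    (hσ1 : σ ≤ 2 * r - k + 1) (hσ2 : ∀ i ≤ r - k, (σ : ℕ∞) ≤ Q.compatSucc A i + i)
    (hσ3 : (σ : ℕ∞) ≤ Q.exactSucc ∨ (σ : ℕ∞) ≤ min (r : ℕ∞) (Q.compatSucc A (r - k)))
    {t₀ T : ℝ} (hT : 0 < T) {f : ℝ → Vec d → Vec d}
    (hf : ContDiffOn ℝ (M + 1 : ℕ) (fun x : ℝ × Vec d => f x.1 x.2)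
      (Set.Icc t₀ (t₀ + T) ×ˢ Set.univ))
    {u : ℝ → Vec d} (hu : ∀ s ∈ Set.Icc t₀ (t₀ + T),
      HasDerivWithinAt u (f s (u s)) (Set.Icc t₀ (t₀ + T)) s) (K₀ : ℝ) :
    ∃ K : ℝ, 0 ≤ K ∧ ∀ (a b : ℝ) (U₀ : Vec d) (P : ℝ → Vec d) (E : ℝ), t₀ ≤ a → a < b →
      b ≤ t₀ + T → b - a ≤ 1 → IsLocalSolution r k Q A f a b U₀ P →
      (∀ l, ∀ s ∈ Set.Icc a b, ‖iteratedDeriv l P s‖ ≤ K₀) →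
      (∀ s ∈ Set.Ioc a b, ‖u s - P s‖ ≤ K₀) → (∀ s ∈ Set.Ioc a b, ‖u s - P s‖ ≤ E) →
      ‖u b - P b‖ ≤ (1 + K * (b - a)) * ‖u a - U₀‖ + K * (b - a) * (E ^ 2 + (b - a) ^ σ) := by
  rcases lt_or_ge K₀ 0 with hK₀ | hK₀
  · refine ⟨0, le_rfl, fun a b U₀ P E _ hab _ _ _ hPK _ _ => ?_⟩
    exact absurd ((norm_nonneg _).trans (hPK 0 a ⟨le_rfl, hab.le⟩)) (not_le.2 hK₀)
  set I := Set.Icc t₀ (t₀ + T) with hI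
  have hIu : UniqueDiffOn ℝ I := uniqueDiffOn_Icc (by linarith)
  have hSu : UniqueDiffOn ℝ (I ×ˢ (Set.univ : Set (Vec d))) := hIu.prod uniqueDiffOn_univ
  set Φ : ℝ × Vec d → Vec d := fun x => f x.1 x.2 with hΦ
  have hΦM : ContDiffOn ℝ M Φ (I ×ˢ Set.univ) := hf.of_le (by exact_mod_cast Nat.le_succ M)
  have hΨM : ContDiffOn ℝ M (sndDeriv I Φ) (I ×ˢ Set.univ) := contDiffOn_sndDeriv hIu hf
  -- Both `P` and `u` take values in the ball of radius `2 K₀`.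
  set S' : Set (ℝ × Vec d) := I ×ˢ Metric.closedBall (0 : Vec d) (2 * K₀) with hS'
  have hS'c : IsCompact S' := isCompact_Icc.prod (isCompact_closedBall _ _)
  have hS'S : S' ⊆ I ×ˢ Set.univ := Set.prod_mono_right (Set.subset_univ _)
  obtain ⟨D1, hD1, hΦD⟩ := exists_iteratedFDerivWithin_bound hΦM hSu hS'c hS'S
  obtain ⟨D2, hD2, hΨD⟩ := exists_iteratedFDerivWithin_bound hΨM hSu hS'c hS'S
  set c₀ : ℝ := |t₀| + T with hc₀
  set inl := ContinuousLinearMap.inl ℝ ℝ (Vec d) with hinl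
  set inr := ContinuousLinearMap.inr ℝ ℝ (Vec d) with hinr
  have hc₀0 : 0 ≤ c₀ := by positivity
  set CG : ℝ := 1 + (‖inl‖ * (c₀ + 1) + ‖inr‖ * K₀) with hCG
  have hCG1 : 1 ≤ CG := le_add_of_nonneg_right (by positivity)
  set CF : ℝ := M.factorial * D1 * CG ^ M with hCF
  have hCF0 : 0 ≤ CF := by positivity
  set CB : ℝ := |(1 / 2 : ℝ)| * (M.factorial * D2 * CG ^ M) with hCB
  have hCB0 : 0 ≤ CB := by positivity
  obtain ⟨KZ, hKZ, hdual⟩ := exists_picard_iterate (𝔸 := Vec d →L[ℝ] Vec d) M CB σ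
  obtain ⟨K1, hK1, href⟩ := RefProblem.exists_abs_defect_functional_le hkr hQu hCQ hCA hQ hA
    hpq hrM hσM hσ1 hσ2 hσ3 (C := CF + K₀ + KZ) (by positivity)
  refine ⟨2 * (KZ * CB) + d * (d * K1) + 2 * (KZ * CB * K₀) + KZ * D2, by positivity,
    fun a b U₀ P E ha hab hb hba hP hPK huK huE => ?_⟩
  set h : ℝ := b - a with hh
  have h0 : 0 < h := by linarith
  have hIcc : Set.Icc a b ⊆ I := Set.Icc_subset_Icc ha hb
  have hPc := hP.poly.contDiff
  have hud := uniqueDiffOn_Icc hab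
  have hPK' : ∀ l, ∀ s ∈ Set.Icc a b, ‖iteratedDerivWithin l P (Set.Icc a b) s‖ ≤ K₀ :=
    fun l s hs => by
      rw [iteratedDerivWithin_eq_iteratedDeriv hud (hPc l).contDiffAt hs]
      exact hPK l s hs
  have hPb : ∀ s ∈ Set.Icc a b, ‖P s‖ ≤ K₀ := fun s hs => by simpa using hPK 0 s hs
  have hTI : ∀ x ∈ RefIcc, fromRef a b x ∈ I := fun x hx => hIcc (fromRef_mem hab hx)
  have hPh : ScaledBound M h K₀ (fun x => P (fromRef a b x)) :=
    ScaledBound.comp_fromRef hab (hPc M).contDiffOn fun l _ => hPK' l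
  have hPd : ContDiff ℝ M (deriv P) :=
    ((contDiff_succ_iff_deriv (n := (M : WithTop ℕ∞))).1 (hPc _)).2.2
  have hPdh : ScaledBound M h K₀ (fun x => deriv P (fromRef a b x)) :=
    ScaledBound.comp_fromRef hab hPd.contDiffOn fun l hl s hs => by
      rw [iteratedDerivWithin_eq_iteratedDeriv hud
        (hPd.of_le (by exact_mod_cast hl)).contDiffAt hs, ← iteratedDeriv_succ']
      exact hPK (l + 1) s hs
  have hTb : ScaledBound M h (c₀ + 1) (fromRef a b) := by
    refine ScaledBound.fromRef hab M fun s hs => ?_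
    have := hIcc hs
    rw [abs_le]
    constructor <;> linarith [this.1, this.2, neg_abs_le t₀, le_abs_self t₀]
  have hG : ScaledBound M h CG (fun x => (fromRef a b x, P (fromRef a b x))) := by
    refine (((hTb.clm inl).add (hPh.clm inr)).congr fun x _ => ?_).mono h0.le ?_
    · simp [hinl, hinr]
    · rw [hCG]; linarith
  have hGS : Set.MapsTo (fun x => (fromRef a b x, P (fromRef a b x))) RefIcc
      (I ×ˢ Set.univ) := fun x hx => ⟨hTI x hx, trivial⟩
  have hGS' : Set.MapsTo (fun x => (fromRef a b x, P (fromRef a b x))) RefIcc S' := by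
    refine fun x hx => ⟨hTI x hx, ?_⟩
    have := hPb _ (fromRef_mem hab hx)
    simp only [mem_closedBall_zero_iff]
    linarith
  have hF : ScaledBound M h CF (fun x => f (fromRef a b x) (P (fromRef a b x))) :=
    ScaledBound.comp hΦM hSu hΦD h0.le hG hCG1 hGS hGS'
  set B : ℝ → Vec d →L[ℝ] Vec d := fun x =>
    (1 / 2 : ℝ) • sndDeriv I Φ (fromRef a b x, P (fromRef a b x)) with hB
  have hBb : ScaledBound M h CB B :=
    (ScaledBound.comp hΨM hSu hΨD h0.le hG hCG1 hGS hGS').const_smul (1 / 2)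
  obtain ⟨Z, Y, hZ, hY, hZ1, hZd, hZY⟩ := hdual h B h0.le hba hBb
  have hone : ‖(1 : Vec d →L[ℝ] Vec d)‖ ≤ 1 := ContinuousLinearMap.norm_id_le
  have hproj : ∀ j : Fin d, ‖(EuclideanSpace.proj j : Vec d →L[ℝ] ℝ)‖ ≤ 1 := fun j =>
    ContinuousLinearMap.opNorm_le_bound _ zero_le_one fun x => by
      simpa using PiLp.norm_apply_le x j
  set J : Vec d := if k = 0 then (2 / h) • (P a - U₀) else 0 with hJ
  set R : ℝ → Vec d := fun x =>
    f (fromRef a b x) (P (fromRef a b x)) - deriv P (fromRef a b x) with hR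
  have hfP : ContDiffOn ℝ M (fun t => f t (P t)) (Set.Icc a b) := by
    have hg : ContDiffOn ℝ M (fun t => (t, P t)) (Set.Icc a b) :=
      (contDiff_id.prodMk (hPc M)).contDiffOn
    exact hΦM.comp hg fun t ht => ⟨hIcc ht, trivial⟩
  -- The defect functional, tested with the rows of the approximate dual solution.
  have hdef : ‖(∫ x in (-1 : ℝ)..1, Z x (R x)) - Z (-1) J‖ ≤ d * (d * (K1 * h ^ σ)) := by
    refine norm_integral_apply_sub_le hZ.continuousOn (hF.continuousOn.sub hPdh.continuousOn)
      fun i j => ?_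
    obtain ⟨W, hWe, hW⟩ := hP.exists_refProblem hab hkr hfP hpq (by omega) j
    have b1 : ScaledBound M h (CF + K₀ + KZ)
        (fun x => f (fromRef a b x) (P (fromRef a b x)) j) :=
      (hF.clm (EuclideanSpace.proj j : Vec d →L[ℝ] ℝ)).mono h0.le (by
        have := mul_le_of_le_one_left hCF0 (hproj j); linarith)
    have b2 : ScaledBound M h (CF + K₀ + KZ) (fun x => W.eval x) := by
      refine ((hPdh.clm (EuclideanSpace.proj j : Vec d →L[ℝ] ℝ)).congr fun x _ => ?_).mono h0.le
        (by have := mul_le_of_le_one_left hK₀ (hproj j); linarith)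
      rw [hWe]
      rfl
    have b3 : ScaledBound M h (CF + K₀ + KZ) (fun x => entry i j (Z x)) :=
      (hZ.clm (entry i j)).mono h0.le (by
        have := mul_le_of_le_one_left hKZ (norm_entry_le i j); linarith)
    have b4 := href h _ _ W _ h0.le hba b1 b2 b3 hW
    have e1 : ∀ x, R x j = f (fromRef a b x) (P (fromRef a b x)) j - W.eval x := fun x => by
      rw [hWe]; rfl
    have e2 : J j * entry i j (Z (-1)) =
        if k = 0 then 2 / (b - a) * (P a - U₀) j * entry i j (Z (-1)) else 0 := by
      rw [hJ]
      split_ifs <;> simp [hh]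
    simp only [e1, e2]
    exact b4
  -- The error equation, whose linear part is `h B e` with `B = ∂ₓf / 2`, on the
  -- reference interval.
  set e : ℝ → Vec d := fun x => u (fromRef a b x) - P (fromRef a b x) with he
  set e' : ℝ → Vec d := fun x =>
    (h / 2) • (f (fromRef a b x) (u (fromRef a b x)) - deriv P (fromRef a b x)) with he'
  have hed : ∀ x ∈ RefIcc, HasDerivWithinAt e (e' x) RefIcc x := fun x hx =>
    hasDerivWithinAt_comp_fromRef hab (g := fun t => u t - P t)
      (((hu _ (hTI x hx)).mono hIcc).sub
        ((hPc 1).differentiable (by norm_num) _).hasDerivAt.hasDerivWithinAt)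
  have huc : ContinuousOn (fun x => u (fromRef a b x)) RefIcc := fun x hx =>
    (hasDerivWithinAt_comp_fromRef hab ((hu _ (hTI x hx)).mono hIcc)).continuousWithinAt
  have hfuc : ContinuousOn (fun x => f (fromRef a b x) (u (fromRef a b x))) RefIcc :=
    hΦM.continuousOn.comp (hTb.continuousOn.prodMk huc) fun x hx => ⟨hTI x hx, trivial⟩
  have hlin : ∀ x ∈ Set.Ioc (-1 : ℝ) 1,
      ‖e' x - (h / 2) • R x - h • B x (e x)‖ ≤ h * (D2 * E ^ 2 / 2) := by
    intro x hx
    have hx' := Set.Ioc_subset_Icc_self hx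
    have hmem := fromRef_mem_Ioc hab hx
    have h1 := hPb _ (Set.Ioc_subset_Icc_self hmem)
    have h2 := huK _ hmem
    have h3 : ‖u (fromRef a b x)‖ ≤ 2 * K₀ := by
      have := norm_le_norm_add_norm_sub' (u (fromRef a b x)) (P (fromRef a b x))
      linarith
    have ht := norm_sub_sub_sndDeriv_le hIu (hf.of_le (by exact_mod_cast (by omega : 2 ≤ M + 1)))
      (fun y hy => hΨD 1 (by omega) y hy) (hTI x hx')
      (x := P (fromRef a b x)) (y := u (fromRef a b x)) (by simp; linarith) (by simpa using h3)
    have hdec : e' x - (h / 2) • R x - h • B x (e x) =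
        (h / 2) • (Φ (fromRef a b x, u (fromRef a b x)) - Φ (fromRef a b x, P (fromRef a b x)) -
          sndDeriv I Φ (fromRef a b x, P (fromRef a b x))
            (u (fromRef a b x) - P (fromRef a b x))) := by
      simp only [he', hR, hB, he, hΦ, smul_apply, smul_sub, smul_smul]
      rw [show h * (1 / 2) = h / 2 by ring]
      abel
    rw [hdec, norm_smul, Real.norm_eq_abs, abs_of_nonneg (by positivity)]
    have hE2 : ‖u (fromRef a b x) - P (fromRef a b x)‖ ^ 2 ≤ E ^ 2 :=
      pow_le_pow_left₀ (norm_nonneg _) (huE _ hmem) 2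
    calc _ ≤ h / 2 * (D2 * E ^ 2) := by
          refine mul_le_mul_of_nonneg_left (ht.trans ?_) (by positivity)
          exact mul_le_mul_of_nonneg_left hE2 hD2
      _ = _ := by ring
  have hrep := norm_apply_sub_apply_sub_integral_le (η := K₀) (ε := KZ * h ^ σ * CB) h0.le hKZ
    (by positivity) hZd hed (hY.continuousOn.mul hBb.continuousOn).neg
    ((hfuc.sub hPdh.continuousOn).const_smul (h / 2))
    (hF.continuousOn.sub hPdh.continuousOn) (fun x hx => hZ.norm_le hx)
    (fun x hx => by
      have e1 : -(Y x * B x) + Z x * B x = (Z x - Y x) * B x := by rw [sub_mul]; abel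
      rw [e1]
      refine (norm_mul_le _ _).trans ?_
      exact mul_le_mul (hZY x hx) (hBb.norm_le hx) (norm_nonneg _) (by positivity))
    (fun x hx => huK _ (fromRef_mem_Ioc hab hx)) hlin
  have hZm1 : ‖Z (-1)‖ ≤ 1 + 2 * (KZ * CB) * h := by
    have hdiff := (convex_Icc (-1 : ℝ) 1).norm_image_sub_le_of_norm_hasDerivWithin_le
      (C := h * (KZ * CB)) hZd (fun y hy => by
        rw [norm_smul, Real.norm_eq_abs, abs_of_nonneg h0.le, norm_neg]
        refine mul_le_mul_of_nonneg_left ((norm_mul_le _ _).trans ?_) h0.le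
        exact mul_le_mul (hY.norm_le hy) (hBb.norm_le hy) (norm_nonneg _) hKZ)
      (show (1 : ℝ) ∈ Set.Icc (-1 : ℝ) 1 by simp) (show (-1 : ℝ) ∈ Set.Icc (-1 : ℝ) 1 by simp)
    rw [hZ1] at hdiff
    have h2 : ‖(-1 : ℝ) - 1‖ = 2 := by norm_num
    rw [h2] at hdiff
    have := norm_le_norm_add_norm_sub' (Z (-1)) 1
    linarith
  have hstart : Z (-1) (e (-1)) = Z (-1) (u a - U₀) - (h / 2) • Z (-1) J := by
    have e1 : e (-1) = (u a - U₀) - (P a - U₀) := by simp [he, fromRef_neg_one]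
    have e2 : (h / 2) • J = P a - U₀ := by
      rw [hJ]
      split_ifs with hk
      · rw [smul_smul, show h / 2 * (2 / h) = 1 by field_simp, one_smul]
      · rw [hP.initial (by omega)]; simp
    rw [e1, map_sub, ← e2, map_smul]
  have hend : Z 1 (e 1) = u b - P b := by simp [hZ1, he, fromRef_one]
  rw [hend, hstart] at hrep
  have hdec : u b - P b = Z (-1) (u a - U₀) +
      (h / 2) • ((∫ x in (-1 : ℝ)..1, Z x (R x)) - Z (-1) J) +
      (u b - P b - (Z (-1) (u a - U₀) - (h / 2) • Z (-1) J) -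
        (h / 2) • ∫ x in (-1 : ℝ)..1, Z x (R x)) := by
    rw [smul_sub]; abel
  have n1 : ‖Z (-1) (u a - U₀)‖ ≤ (1 + 2 * (KZ * CB) * h) * ‖u a - U₀‖ :=
    (ContinuousLinearMap.le_opNorm _ _).trans (by gcongr)
  have n2 : ‖(h / 2) • ((∫ x in (-1 : ℝ)..1, Z x (R x)) - Z (-1) J)‖ ≤
      h / 2 * (d * (d * (K1 * h ^ σ))) := by
    rw [norm_smul, Real.norm_eq_abs, abs_of_nonneg (by positivity)]
    gcongr
  rw [hdec]
  refine (norm_add₃_le.trans (add_le_add_three n1 n2 hrep)).trans ?_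
  refine le_trans (le_of_eq ?_) (combine_bounds (X := 2 * (KZ * CB)) (X₁ := d * (d * K1))
    (X₂ := 2 * (KZ * CB * K₀)) (X₃ := KZ * D2) (by positivity) (by positivity) (by positivity)
    (by positivity) h0.le (norm_nonneg (u a - U₀)) (sq_nonneg E) (pow_nonneg h0.le σ))
  ring

/-! ### Accumulation over the mesh -/

/-- A discrete Gronwall inequality for a recursion along the steps of a mesh. -/
theorem le_exp_mul_of_mesh_recursion {N : ℕ} {t ε : ℕ → ℝ} {K b : ℝ} (hK : 0 ≤ K) (hb : 0 ≤ b)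
    (ht : ∀ n < N, t n ≤ t (n + 1)) (h0 : ε 0 = 0)
    (hε : ∀ n < N, ε (n + 1) ≤ (1 + K * (t (n + 1) - t n)) * ε n + K * (t (n + 1) - t n) * b) :
    ∀ n ≤ N, ε n ≤ Real.exp (K * (t n - t 0)) * (K * (t n - t 0) * b) := by
  have hmono : ∀ n ≤ N, t 0 ≤ t n := by
    intro n
    induction n with
    | zero => exact fun _ => le_rfl
    | succ n ih => exact fun hn => (ih (by omega)).trans (ht n (by omega))
  intro n
  induction n with
  | zero => intro _; simp [h0]
  | succ n ih =>
    intro hn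
    have h1 := ht n (by omega)
    have h2 := hmono n (by omega)
    set τ := t (n + 1) - t n with hτ
    have hτ0 : 0 ≤ τ := by linarith
    have hKτ : 0 ≤ K * τ := by positivity
    have hexp : 1 + K * τ ≤ Real.exp (K * τ) := by
      have := Real.add_one_le_exp (K * τ); linarith
    have e1 : Real.exp (K * (t (n + 1) - t 0)) =
        Real.exp (K * τ) * Real.exp (K * (t n - t 0)) := by
      rw [← Real.exp_add]; congr 1; rw [hτ]; ring
    have hone : 1 ≤ Real.exp (K * (t (n + 1) - t 0)) :=
      Real.one_le_exp (mul_nonneg hK (by linarith))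
    have hx : 0 ≤ Real.exp (K * (t n - t 0)) * (K * (t n - t 0) * b) := by
      have : 0 ≤ t n - t 0 := by linarith
      positivity
    calc ε (n + 1) ≤ (1 + K * τ) * ε n + K * τ * b := hε n (by omega)
      _ ≤ (1 + K * τ) * (Real.exp (K * (t n - t 0)) * (K * (t n - t 0) * b)) + K * τ * b := by
          gcongr
          exact ih (by omega)
      _ ≤ Real.exp (K * τ) * (Real.exp (K * (t n - t 0)) * (K * (t n - t 0) * b)) +
          Real.exp (K * (t (n + 1) - t 0)) * (K * τ * b) := by
          refine add_le_add (mul_le_mul_of_nonneg_right hexp hx) ?_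
          exact le_mul_of_one_le_left (by positivity) hone
      _ = _ := by rw [e1, hτ]; ring

theorem superOrder_cast {q p : ℕ} (r k : ℕ) (Q : RefIntegrator q) (A : RefApprox p) :
    (superOrder r k Q A : ℕ∞) = min ((2 * r - k + 1 : ℕ) : ℕ∞)
      (min (⨅ i ∈ Finset.range (r - k + 1), (Q.compatSucc A i + i))
        (max Q.exactSucc (min (r : ℕ∞) (Q.compatSucc A (r - k))))) :=
  ENat.natCast_toNat (ne_top_of_le_ne_top (ENat.natCast_ne_top _) (min_le_left _ _))

/-- Bounds for the derivatives of `U` on a half-open mesh interval carry over to the closed one. -/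
theorem norm_iteratedDeriv_le_of_eqOn {d s : ℕ} {a b K : ℝ} (hab : a < b) {U P : ℝ → Vec d}
    (hP : IsVecPoly s P) (hUP : Set.EqOn U P (Set.Ioc a b)) {l : ℕ}
    (hU : ∀ x ∈ Set.Ioc a b, ‖iteratedDerivWithin l U (Set.Ioc a b) x‖ ≤ K) :
    ∀ x ∈ Set.Icc a b, ‖iteratedDeriv l P x‖ ≤ K := by
  have hud : UniqueDiffOn ℝ (Set.Ioc a b) :=
    uniqueDiffOn_Ioc a b
  have hsub : Set.Ioc a b ⊆ {x | ‖iteratedDeriv l P x‖ ≤ K} := fun x hx => by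
    have := hU x hx
    rwa [iteratedDerivWithin_congr hUP hx,
      iteratedDerivWithin_eq_iteratedDeriv hud (hP.contDiff l).contDiffAt hx] at this
  have hcl : IsClosed {x | ‖iteratedDeriv l P x‖ ≤ K} :=
    isClosed_le ((hP.contDiff l).continuous_iteratedDeriv l le_rfl).norm continuous_const
  have := hcl.closure_subset_iff.2 hsub
  rw [closure_Ioc hab.ne] at this
  exact fun x hx => this hx

theorem mainTheorem3 (d r k : ℕ) (hkr : k ≤ r) (q p : ℕ)
    (Q : RefIntegrator q) (A : RefApprox p)
    (hQu : Q.Unisolvent r k) (hQs : Q.Stable d) (hAs : A.Stable d q) :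
    ∃ m : ℕ, ∀ (t₀ T : ℝ) (_ : 0 < T) (f : ℝ → Vec d → Vec d) (L : NNReal)
      (_ : ContDiffOn ℝ m (fun x : ℝ × Vec d => f x.1 x.2) (Set.Icc t₀ (t₀ + T) ×ˢ Set.univ))
      (_ : ∀ s ∈ Set.Icc t₀ (t₀ + T), LipschitzWith L (f s))
      (u₀ : Vec d) (u : ℝ → Vec d) (_ : u t₀ = u₀)
      (_ : ∀ s ∈ Set.Icc t₀ (t₀ + T),
        HasDerivWithinAt u (f s (u s)) (Set.Icc t₀ (t₀ + T)) s)
      (K : ℝ),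
      ∃ C : ℝ, ∀ (N : ℕ) (t : ℕ → ℝ) (U : ℝ → Vec d), IsMesh t₀ T N t →
        IsDiscreteSolution r k Q A f u₀ N t U →
        (∀ s ∈ Set.Ioc t₀ (t₀ + T), ‖u s - U s‖ ≤ K) →
        (∀ n < N, ∀ l : ℕ, ∀ s ∈ Set.Ioc (t n) (t (n + 1)),
          ‖iteratedDerivWithin l U (Set.Ioc (t n) (t (n + 1))) s‖ ≤ K) →
        ‖u (t N) - U (t N)‖ ≤
          C * (supNormOn (Set.Ioc t₀ (t₀ + T)) (fun s => u s - U s) ^ 2 +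
            meshSize N t ^ superOrder r k Q A) := by
  rcases Nat.eq_zero_or_pos d with rfl | hd
  · -- In dimension zero every vector is zero.
    refine ⟨0, fun t₀ T _ f L _ _ u₀ u _ _ K => ⟨0, fun N t U _ _ _ _ => ?_⟩⟩
    rw [Subsingleton.elim (u (t N) - U (t N)) 0, norm_zero, zero_mul]
  obtain ⟨CQ, hCQ, hQ⟩ := hQs.exists_scalar ⟨0, hd⟩
  obtain ⟨CA, hCA, hA⟩ := hAs.exists_scalar ⟨0, hd⟩
  set σ := superOrder r k Q A with hσ
  have hσc := superOrder_cast r k Q A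
  rw [← hσ] at hσc
  have hσ1 : σ ≤ 2 * r - k + 1 := by
    have : (σ : ℕ∞) ≤ ((2 * r - k + 1 : ℕ) : ℕ∞) := hσc.le.trans (min_le_left _ _)
    exact_mod_cast this
  have hσ2 : ∀ i ≤ r - k, (σ : ℕ∞) ≤ Q.compatSucc A i + i := fun i hi =>
    (hσc.le.trans ((min_le_right _ _).trans (min_le_left _ _))).trans
      (iInf₂_le i (Finset.mem_range.2 (by omega)))
  have hσ3 : (σ : ℕ∞) ≤ Q.exactSucc ∨ (σ : ℕ∞) ≤ min (r : ℕ∞) (Q.compatSucc A (r - k)) :=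
    le_max_iff.1 (hσc.le.trans ((min_le_right _ _).trans (min_le_right _ _)))
  -- One derivative more than `M` is needed because `∂ₓf` has to be `M` times differentiable.
  set M : ℕ := max p q + (r + 1) + σ with hM
  refine ⟨M + 1, fun t₀ T hT f L hf _ u₀ u hu₀ hu K₀ => ?_⟩
  obtain ⟨K, hK, hstep⟩ := exists_local_error_bound hkr hQu hCQ hCA hQ hA (M := M) (by omega)
    (by omega) (by omega) hσ1 hσ2 hσ3 hT hf hu K₀
  refine ⟨Real.exp (K * T) * (K * T), fun N t U hmesh hU huK hUK => ?_⟩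
  have hle : ∀ n < N, t n ≤ t (n + 1) := fun n hn => (hmesh.lt n hn).le
  have hlow : ∀ n ≤ N, t₀ ≤ t n := by
    intro n
    induction n with
    | zero => exact fun _ => hmesh.first.ge
    | succ n ih => exact fun hn => (ih (by omega)).trans (hle n (by omega))
  have hupp : ∀ j ≤ N, t (N - j) ≤ t₀ + T := by
    intro j
    induction j with
    | zero => exact fun _ => hmesh.last.le
    | succ j ih =>
      intro hj
      have := hle (N - (j + 1)) (by omega)
      rw [show N - (j + 1) + 1 = N - j by omega] at this
      exact this.trans (ih (by omega))
  have hupp' : ∀ n ≤ N, t n ≤ t₀ + T := fun n hn => by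
    have := hupp (N - n) (by omega)
    rwa [Nat.sub_sub_self hn] at this
  set E := supNormOn (Set.Ioc t₀ (t₀ + T)) (fun s => u s - U s) with hE
  set τ := meshSize N t with hτ
  have hτn : ∀ n < N, t (n + 1) - t n ≤ τ := fun n hn =>
    le_ciSup (f := fun n : Fin N => t (n + 1) - t n) (Set.finite_range _).bddAbove ⟨n, hn⟩
  have hτ0 : 0 ≤ τ := Real.iSup_nonneg fun n => by have := hle n n.2; linarith
  have hEs : ∀ s ∈ Set.Ioc t₀ (t₀ + T), ‖u s - U s‖ ≤ E := fun s hs =>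
    le_csSup ⟨K₀, by rintro _ ⟨x, hx, rfl⟩; exact huK x hx⟩
      (Set.mem_image_of_mem (fun s => ‖u s - U s‖) hs)
  have hmain := le_exp_mul_of_mesh_recursion (N := N) (t := t) (ε := fun n => ‖u (t n) - U (t n)‖)
    (b := E ^ 2 + τ ^ σ) hK (by positivity) hle
    (by rw [hmesh.first, hu₀, ← hmesh.first, hU.initial, sub_self, norm_zero])
    (fun n hn => by
      obtain ⟨P, hUP, hP⟩ := hU.step n hn
      have hlt := hmesh.lt n hn
      have hsub : Set.Ioc (t n) (t (n + 1)) ⊆ Set.Ioc t₀ (t₀ + T) :=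
        Set.Ioc_subset_Ioc (hlow n hn.le) (hupp' (n + 1) hn)
      have hs := hstep (t n) (t (n + 1)) (U (t n)) P E (hlow n hn.le) hlt (hupp' (n + 1) hn)
        (hmesh.step_le_one n hn) hP
        (fun l => norm_iteratedDeriv_le_of_eqOn hlt hP.poly hUP (hUK n hn l))
        (fun s hs => by rw [← hUP hs]; exact huK s (hsub hs))
        (fun s hs => by rw [← hUP hs]; exact hEs s (hsub hs))
      rw [← hUP ⟨hlt, le_rfl⟩] at hs
      refine hs.trans ?_
      have h0 : 0 ≤ t (n + 1) - t n := by linarith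
      have := pow_le_pow_left₀ h0 (hτn n hn) σ
      gcongr) N le_rfl
  have hlen : t N - t 0 = T := by rw [hmesh.last, hmesh.first]; ring
  rw [hlen] at hmain
  refine hmain.trans (le_of_eq ?_)
  ring
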